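/- **Setting.** Fix a finite field $\mathbb F$, a subset $H\subseteq\mathbb F$, integers $m,d,D\ge 1$ with $D\le|\mathbb F|$, and put $\mu=2^m$. Let $\mathcal P$ be the space of $\mu$-variate polynomials over $\mathbb F$ with partial degrees $\le d$ and total degree $\le D$. A polynomial in fewer variables is regarded as a polynomial in the first of the $\mu$ variables, and a value at a shorter point is a value at that point padded with zeros. $\lambda$ is the security parameter, PPT means probabilistic polynomial time in $\lambda$, and a function $\varepsilon:\mathbb N\to\mathbb R$ is negligible if for every integer $c>0$ one has $|\varepsilon(\lambda)|<\lambda^{-c}$ for all large $\lambda$. **Commitment scheme.** A PCS for $\mathcal P$ with batched evaluation consists of a randomised $\mathsf{Setup}(1^\lambda)$ producing public parameters $\mathsf{pp}$; a deterministic $\mathsf{Commit}(\mathsf{pp},f)$; an algorithm $\mathsf{Open}(\mathsf{pp},f,C)$ that accepts iff $C=\mathsf{Commit}(\mathsf{pp},f)$; and, for every $\ell$, an interactive protocol $\ell\text{-}\mathsf{Eval}$ with polynomially many rounds for claims about the values $y_1,\dots,y_\ell$ of the polynomials committed to in $C_1,\dots,C_\ell$ at a common point $x\in\mathbb F^\mu$,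 where the variables of each polynomial may be shifted (each variable is read at a prescribed coordinate of $x$, or set to $0$); it has a PPT honest prover which, given polynomials $f_i$ with $C_i=\mathsf{Commit}(\mathsf{pp},f_i)$, always convinces the verifier of the true values. The scheme is * *extractable* if for every PPT $A$ there is a PPT $E$ such that, for $\mathsf{pp}\leftarrow\mathsf{Setup}(1^\lambda)$, $C\leftarrow A(\mathsf{pp})$, $f\leftarrow E(C,\mathsf{pp})$, the probability that $C=\mathsf{Commit}(\mathsf{pp},g)$ for some $g\in\mathcal P$ but $\mathsf{Open}(\mathsf{pp},f,C)$ rejects is negligible; * *computationally binding* if for every PPT $A$ the probability that $A(\mathsf{pp})$ outputs $f\ne g$ and $C$ such that $\mathsf{Open}(\mathsf{pp},f,C)$ and $\mathsf{Open}(\mathsf{pp},g,C)$ accept is negligible; * *computationally $\ell$-batch evaluation binding* if for all PPT $A$ and $\tilde P$, with $(C_i)_i,x,y,y'\leftarrow A(\mathsf{pp})$, the probability that $y_i\ne y_i'$ for some $i$, while $\tilde P$ convinces the verifier of $\ell\text{-}\mathsf{Eval}$ both on input $((C_i)_i,x,y)$ and on input $((C_i)_i,x,y')$, is negligible. **Protocol.**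 $\mathsf{US}$ is a univariate sumcheck protocol over $H$ with soundness error $p$: for every univariate $g$ with $\deg g\le d$ and every $s\neq\sum_{a\in H}g(a)$, no (unbounded) prover makes the verifier, who has oracle access to $g$, accept the claimed sum $s$ with probability more than $p$. In $\mathsf{Fold}\text{-}\mathsf{DCS}$ instantiated with the PCS and $\mathsf{US}$, the verifier has oracle access to $f\in\mathcal P$ and is given a claimed sum $S\in\mathbb F$; $\mathsf{pp}\leftarrow\mathsf{Setup}(1^\lambda)$ is public. 1. For $i=1,\dots,m$ the prover sends a commitment $C_i$ (to a $2^{m-i}$-variate polynomial $f^{(i)}_0$), and then the verifier sends uniformly random $\alpha^{(i)}\in\mathbb F^{2^{m-i}}$ and $z^{(i)}\in\mathbb F$. 2. The prover sends a commitment $C$ (to a univariate polynomial $f^{(m)}$), and the verifier sends a uniformly random $\beta\in\mathbb F$. The prover sends alleged values $y_i$ of $f^{(i)}_0(\alpha^{(i)})$ and $y'_i$ of $f^{(i)}_0(\alpha^{(i+1)},\dots,\alpha^{(m)},\beta)$ for $1\le i\le m$, and $w$ of $f^{(m)}(\beta)$, and fixes a polynomial $g\in\mathcal P$ as the oracle for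 step 4; $\mathsf{Open}(\mathsf{pp},g,C)$ has to accept. 3. The $\ell=2m+1=2\log_2\mu+1$ alleged values are checked by one run of $\ell\text{-}\mathsf{Eval}$ at the point $(\alpha^{(1)},\dots,\alpha^{(m)},\beta)$, and the verifier checks $w=f(\alpha^{(1)},\dots,\alpha^{(m)},\beta)+\sum_{j=1}^m z^{(j)}y'_j$. 4. $\mathsf{US}$ is run on the univariate polynomial $g(x,0,\dots,0)$ with the claimed sum $\prod_{j=1}^m z^{(j)}\,S+\sum_{j=1}^m\bigl(\prod_{k>j}z^{(k)}\bigr)y_j$. The verifier accepts if all checks succeed; the messages $C_1,\dots,C_m$ are required to be commitments, i.e. values of $\mathsf{Commit}(\mathsf{pp},\cdot)$. **Corollary (computational soundness).** Suppose that the PCS is extractable, computationally binding and computationally $\ell$-batch evaluation binding for the $\ell=2\log_2\mu+1$ evaluations of step 3. Then for every PPT prover $\tilde P$ there are non-negative negligible functions $\varepsilon,\sigma$ such that for all $\lambda$, all $f\in\mathcal P$ and all $S\in\mathbb F$ with $\sum_{a\in H^\mu}f(a)\ne S$, the verifier accepts in interaction with $\tilde P(f,S)$ with probability at most $$(m+1)\varepsilon(\lambda)+1-\left(1-\left(\frac{D+1}{|\mathbb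 F|}-\frac{D}{|\mathbb F|^2}\right)\right)^m\left(1-\max\left(p,\frac{D}{|\mathbb F|}\right)+\sigma(\lambda)\right).$$ If $p\le D/|\mathbb F|$, then this bound is at most $(m+1)\left(\varepsilon(\lambda)+\frac{D+1}{|\mathbb F|}(1+\sigma(\lambda))\right)$ for all $\lambda$. -/

import Mathlib

/-! ### Computation model: randomised programs over binary trees, with a step count -/

/-- Binary trees: the data on which programs act. -/
inductive Dat : Type
  | nil : Dat
  | cons : Dat → Dat → Dat

namespace Dat

/-- Left subtree (`nil` for `nil`). -/
def hd : Dat → Dat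
  | nil => nil
  | cons a _ => a

/-- Right subtree (`nil` for `nil`). -/
def tl : Dat → Dat
  | nil => nil
  | cons _ b => b

/-- Unary numerals. -/
def num : ℕ → Dat
  | 0 => nil
  | n + 1 => cons nil (num n)

/-- A list of trees as a tree. -/
def ofList : List Dat → Dat
  | [] => nil
  | a :: l => cons a (ofList l)

/-- The entry of index `i` of a tree that is read as a list. -/
def nth (t : Dat) (i : ℕ) : Dat := (tl^[i] t).hd

end Dat

/-- Programs of a small functional language on trees (the data operations of the `WHILE` language).
`pair p q` sends `x` to `cons (p x) (q x)`; `comp q p` runs `p` and then `q`; `cond c p q` runs `p`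
if the value of `c` is not `nil`, and `q` otherwise; `rand k` draws a uniform numeral from
`{0, …, k}`; `loop b` replaces `x` by `b x` as long as the left subtree of `x` is not `nil`, and
then returns the right subtree of `x`. -/
inductive Prog : Type
  | id : Prog
  | nil : Prog
  | hd : Prog
  | tl : Prog
  | pair : Prog → Prog → Prog
  | comp : Prog → Prog → Prog
  | cond : Prog → Prog → Prog → Prog
  | rand : ℕ → Prog
  | loop : Prog → Prog

noncomputable section

namespace Prog

/-- The result of an execution: a value and the number of steps, or `none` if it was cut off. -/
abbrev Res := PMF (Option (Dat × ℕ))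

/-- A finished execution with value `y` after `t` steps. -/
def ret (y : Dat) (t : ℕ) : Res := PMF.pure (some (y, t))

/-- Sequencing of executions. -/
def andThen (r : Res) (k : Dat → ℕ → Res) : Res :=
  r.bind fun o => match o with
    | none => PMF.pure none
    | some (y, t) => k y t

/-- At most `N` passes through a loop with body `b`, after `t` steps; each test is one step. -/
def loopExec (b : Dat → Res) : ℕ → Dat → ℕ → Res
  | _, Dat.nil, t => ret Dat.nil (t + 1)
  | _, Dat.cons Dat.nil y, t => ret y (t + 1)
  | 0, Dat.cons (Dat.cons _ _) _, _ => PMF.pure none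
  | N + 1, Dat.cons (Dat.cons u v) y, t =>
      andThen (b (Dat.cons (Dat.cons u v) y)) fun x' s => loopExec b N x' (t + s + 1)

/-- Execution of a program on an input, where no loop may make more than `N` passes: every
operation is one step. An execution of at most `N` steps is never cut off. -/
def exec (N : ℕ) : Prog → Dat → Res
  | id, x => ret x 1
  | nil, _ => ret Dat.nil 1
  | hd, x => ret x.hd 1
  | tl, x => ret x.tl 1
  | pair p q, x =>
      andThen (exec N p x) fun y s => andThen (exec N q x) fun z t => ret (Dat.cons y z) (s + t + 1)
  | comp q p, x =>
      andThen (exec N p x) fun y s => andThen (exec N q y) fun z t => ret z (s + t + 1)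
  | cond c p q, x =>
      andThen (exec N c x) fun y s => match y with
        | Dat.nil => andThen (exec N q x) fun z t => ret z (s + t + 1)
        | Dat.cons _ _ => andThen (exec N p x) fun z t => ret z (s + t + 1)
  | rand k, _ => (PMF.uniformOfFintype (Fin (k + 1))).bind fun i => ret (Dat.num i) 1
  | loop b, x => loopExec (exec N b) N x 0

end Prog

/-- A probabilistic polynomial-time algorithm: a program which, given the security parameter in
unary and any further input, halts within a polynomial number of steps in the security parameter,
whatever its random choices. -/
structure PPT where
  code : Prog
  bound : Polynomial ℕ
  halts : ∀ (sec : ℕ) (x : Dat),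
    ∀ o ∈ (code.exec (bound.eval sec) (Dat.cons (Dat.num sec) x)).support,
      ∃ y t, o = some (y, t) ∧ t ≤ bound.eval sec

/-- The output distribution of an algorithm for security parameter `sec` on input `x`. -/
def PPT.run (A : PPT) (sec : ℕ) (x : Dat) : PMF Dat :=
  (A.code.exec (A.bound.eval sec) (Dat.cons (Dat.num sec) x)).map
    fun o => (o.map Prod.fst).getD Dat.nil

/-- Negligible functions. -/
def Negligible (f : ℕ → ℝ) : Prop :=
  ∀ c : ℕ, 0 < c → ∃ N : ℕ, ∀ n : ℕ, N ≤ n → |f n| < (n : ℝ) ^ (-(c : ℤ))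

/-- The probability of the outcome `true`. -/
def prob (q : PMF Bool) : ℝ := (q true).toReal

/-! ### Interaction -/

/-- `k` moves of a party whose behaviour is given by `step`, which maps a state and an incoming
message to a new state and a reply. The incoming message is `next h`, where `h` is the list of the
earlier replies. The result is the final state and the list of all replies. -/
def talk (step : Dat → PMF Dat) (next : List Dat → Dat) :
    ℕ → Dat → List Dat → PMF (Dat × List Dat)
  | 0, st, h => PMF.pure (st, h)
  | k + 1, st, h =>
      (step (Dat.cons st (next h))).bind fun o => talk step next k o.hd (h ++ [o.tl])

/-- The verifier of an interactive protocol: her coins, the number of rounds, her message as a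
function of her coins and of the replies received so far, and her decision. -/
structure Verifier where
  Coins : Type
  coins : PMF Coins
  rounds : ℕ
  msg : Coins → List Dat → Dat
  accept : Coins → List Dat → Bool

/-- Interaction of a prover in state `st` with a verifier: her decision and his final state. -/
def Verifier.interact (V : Verifier) (step : Dat → PMF Dat) (st : Dat) : PMF (Bool × Dat) :=
  V.coins.bind fun w =>
    (talk step (V.msg w) V.rounds st []).map fun r => (V.accept w r.2, r.1)

/-- The probability that the verifier accepts. -/
def Verifier.acceptProb (V : Verifier) (step : Dat → PMF Dat) (st : Dat) : ℝ :=
  prob ((V.interact step st).map Prod.fst)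

/-- The state in which an interactive algorithm with input `x` begins. -/
def startState (x : Dat) : Dat := Dat.cons Dat.nil x

/-! ### Encodings of finite data and bounded-degree polynomials -/

/-- The elements of a finite type as numerals, in a fixed enumeration. -/
def code {α : Type*} [Fintype α] (a : α) : Dat := Dat.num (Fintype.equivFin α a)

/-- Decoding; `none` for a tree that is not a code. -/
def decode (α : Type*) [Fintype α] : Dat → Option α := Function.partialInv (code (α := α))

/-- Polynomials in `k` variables with partial degrees at most `d` and total degree at most `D`. -/
abbrev BPoly (F : Type*) [Field F] (k d D : ℕ) :=
  {f : MvPolynomial (Fin k) F // (∀ i, f.degreeOf i ≤ d) ∧ f.totalDegree ≤ D}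

section

variable {F : Type*} [Field F] [Fintype F] {k d D : ℕ}

/-- A polynomial is encoded by the table of its coefficients. -/
def codePoly (f : BPoly F k d D) : Dat :=
  code (fun e : Fin k → Fin (d + 1) =>
    f.1.coeff (Finsupp.equivFunOnFinite.symm fun i => (e i : ℕ)))

/-- Decoding of polynomials; `none` for a tree that is not the code of one. -/
def decodePoly (F : Type*) [Field F] [Fintype F] (k d D : ℕ) : Dat → Option (BPoly F k d D) :=
  Function.partialInv codePoly

/-- Points of affine space, encoded. -/
def codeVec (x : Fin k → F) : Dat := code x

/-- Decoding of points. -/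
def decodeVec (F : Type*) [Fintype F] (k : ℕ) : Dat → Option (Fin k → F) := decode (Fin k → F)

end

/-! ### Polynomial commitment schemes with batched evaluation -/

/-- A placement of the variables: the variable `i` of a polynomial is read at the coordinate `π i`
of a point, or as `0` if `π i = none`. -/
abbrev Placement (k : ℕ) := Fin k → Option (Fin k)

/-- The point at which a polynomial with variables placed by `π` is evaluated. -/
def Placement.point {F : Type*} [Zero F] {k : ℕ} (π : Placement k) (x : Fin k → F) : Fin k → F :=
  fun i => ((π i).map x).getD 0

/-- A `k`-variate `(d, D)`-degree polynomial commitment scheme over `F` that allows batched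
evaluation. The evaluation protocol for `ℓ` commitments `C i`, a common point `x`, alleged
values `y i` and placements `π i` is about the claims that the polynomial committed to in `C i` has
the value `y i` at `(π i).point x`; with the identical placements this is the evaluation at `x`. -/
structure PCS (F : Type*) [Field F] [Fintype F] (k d D : ℕ) where
  setup : ℕ → PMF Dat
  commit : Dat → BPoly F k d D → Dat
  /-- `opens pp f C` decides whether `C` is correctly computed from `f`. -/
  opens : Dat → BPoly F k d D → Dat → Bool
  opens_iff : ∀ pp f C, opens pp f C = true ↔ C = commit pp f
  /-- The verifier, given `sec`, `pp`, the commitments, the point and the alleged values. -/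
  evalV : ∀ {ℓ : ℕ}, (Fin ℓ → Placement k) → ℕ → Dat → (Fin ℓ → Dat) → (Fin k → F) →
    (Fin ℓ → F) → Verifier
  /-- The honest prover. -/
  evalP : ∀ {ℓ : ℕ}, (Fin ℓ → Placement k) → PPT
  rounds_le : ∀ {ℓ : ℕ} (π : Fin ℓ → Placement k), ∃ q : Polynomial ℕ,
    ∀ sec pp C x y, (evalV π sec pp C x y).rounds ≤ q.eval sec
  /-- The honest prover, given the committed polynomials, convinces the verifier of their
  values. -/
  complete : ∀ {ℓ : ℕ} (π : Fin ℓ → Placement k) (sec : ℕ), ∀ pp ∈ (setup sec).support,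
    ∀ (f : Fin ℓ → BPoly F k d D) (x : Fin k → F) (C : Fin ℓ → Dat) (y : Fin ℓ → F),
      (∀ i, C i = commit pp (f i)) →
      (∀ i, y i = MvPolynomial.eval ((π i).point x) (f i).1) →
      (evalV π sec pp C x y).acceptProb ((evalP π).run sec)
        (startState (Dat.cons (Dat.ofList (List.ofFn fun i => codePoly (f i)))
          (Dat.cons pp (Dat.cons (Dat.ofList (List.ofFn C))
            (Dat.cons (codeVec x) (codeVec y)))))) = 1

namespace PCS

variable {F : Type*} [Field F] [Fintype F] {k d D : ℕ} (S : PCS F k d D)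

/-- `C` is a commitment to some polynomial. -/
def IsCommitment (pp C : Dat) : Prop := ∃ g, C = S.commit pp g

open Classical in
/-- Extractability: for every adversary that outputs a tree `C` there is an extractor which, given
`C` and the public parameters, outputs a polynomial; the probability that `C` is a commitment but
the output does not open it is negligible. -/
def Extractable : Prop :=
  ∀ A : PPT, ∃ E : PPT, Negligible fun sec =>
    prob ((S.setup sec).bind fun pp =>
      (A.run sec pp).bind fun C =>
        (E.run sec (Dat.cons C pp)).map fun t =>
          decide (S.IsCommitment pp C ∧
            ¬ ∃ f, decodePoly F k d D t = some f ∧ S.opens pp f C = true))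

open Classical in
/-- Computational binding: no adversary opens a commitment to two different polynomials. -/
def Binding : Prop :=
  ∀ A : PPT, Negligible fun sec =>
    prob ((S.setup sec).bind fun pp =>
      (A.run sec pp).map fun t =>
        decide (∃ f g, decodePoly F k d D t.hd = some f ∧ decodePoly F k d D t.tl.hd = some g ∧
          f ≠ g ∧ S.opens pp f t.tl.tl = true ∧ S.opens pp g t.tl.tl = true))

/-- The interaction of a (cheating) prover with the evaluation verifier, on common input. -/
def evalGame {ℓ : ℕ} (π : Fin ℓ → Placement k) (P : PPT) (sec : ℕ) (pp : Dat) (C : Fin ℓ → Dat)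
    (x : Fin k → F) (y : Fin ℓ → F) : PMF Bool :=
  ((S.evalV π sec pp C x y).interact (P.run sec)
    (startState (Dat.cons pp (Dat.cons (Dat.ofList (List.ofFn C))
      (Dat.cons (codeVec x) (codeVec y)))))).map Prod.fst

open Classical in
/-- Computational `ℓ`-batch evaluation binding: no adversary `A`, `P` finds commitments, a point
and two different tuples of values such that `P` convinces the verifier of both tuples. -/
def BatchEvalBinding {ℓ : ℕ} (π : Fin ℓ → Placement k) : Prop :=
  ∀ A P : PPT, Negligible fun sec =>
    prob ((S.setup sec).bind fun pp =>
      (A.run sec pp).bind fun t =>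
        match decodeVec F k (t.nth 1), decodeVec F ℓ (t.nth 2), decodeVec F ℓ (t.nth 3) with
        | some x, some y, some y' =>
            (S.evalGame π P sec pp (fun i => t.hd.nth i) x y).bind fun b =>
              (S.evalGame π P sec pp (fun i => t.hd.nth i) x y').map fun b' =>
                decide ((∃ i, y i ≠ y' i) ∧ b = true ∧ b' = true)
        | _, _, _ => PMF.pure false)

end PCS

/-! ### Univariate sumcheck -/

/-- The verifier of a univariate sumcheck protocol, with oracle access to a polynomial, for a
claimed sum. -/
abbrev USVerifier (F : Type*) [Field F] := Polynomial F → F → Verifier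

/-- The univariate sumcheck over `H` for polynomials of degree at most `d` has soundness error at
most `p`, against unbounded provers. -/
def USVerifier.HasSoundnessError {F : Type*} [Field F] (US : USVerifier F) (H : Finset F) (d : ℕ)
    (p : ℝ) : Prop :=
  ∀ (g : Polynomial F) (s : F), g.natDegree ≤ d → ∑ a ∈ H, g.eval a ≠ s →
    ∀ (step : Dat → PMF Dat) (st : Dat), (US g s).acceptProb step st ≤ p

/-! ### The protocol Fold-DCS for `2 ^ m`-variate polynomials

All random points of the verifier form one point `X` of `F ^ (2 ^ m)`,
namely `X = (α⁽¹⁾, …, α⁽ᵐ⁾, β)`. Rounds are numbered from `0`: the block of round `j < m` begins at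
the coordinate `2 ^ m - 2 ^ (m - j)` and has length `2 ^ (m - 1 - j)`. -/

/-- The first `len` variables are placed at the coordinates `start, start + 1, …`. -/
def window (k start len : ℕ) : Placement k :=
  fun i => if h : i.val < len ∧ start + i.val < k then some ⟨start + i.val, h.2⟩ else none

/-- Placement of the polynomial of round `j` for its value at the point of round `j`. -/
def blockWindow (m j : ℕ) : Placement (2 ^ m) :=
  window (2 ^ m) (2 ^ m - 2 ^ (m - j)) (2 ^ (m - 1 - j))

/-- Placement of the polynomial of round `j` for its value at the points of all later rounds,
followed by `β`. -/
def tailWindow (m j : ℕ) : Placement (2 ^ m) :=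
  window (2 ^ m) (2 ^ m - 2 ^ (m - 1 - j)) (2 ^ (m - 1 - j))

/-- The placements of the `2 m + 1` evaluations: the values used for the claimed sum, the values
used for the consistency check, and the value at `β` of the final univariate polynomial. -/
def foldPlacement (m : ℕ) : Fin (2 * m + 1) → Placement (2 ^ m) := fun i =>
  if i.val < m then blockWindow m i.val
  else if i.val < 2 * m then tailWindow m (i.val - m)
  else window (2 ^ m) (2 ^ m - 1) 1

/-- The commitments for these evaluations, where `C j` is the commitment of round `j` for `j < m`,
and `C m` is the commitment to the final univariate polynomial. -/
def foldCommitments (m : ℕ) (C : ℕ → Dat) : Fin (2 * m + 1) → Dat := fun i =>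
  if i.val < m then C i.val else if i.val < 2 * m then C (i.val - m) else C m

section

variable {F : Type*} [Field F] [Fintype F]

/-- The message of the verifier before the reply `i` of the prover: nothing for `i = 0`, the random
point and the random scalar of round `i - 1` for `1 ≤ i ≤ m`, and `β` for `i = m + 1`. -/
def foldMsg (m : ℕ) (X : Fin (2 ^ m) → F) (z : Fin m → F) (i : ℕ) : Dat :=
  if i = 0 then Dat.nil
  else if h : i - 1 < m then
    Dat.cons (codeVec ((blockWindow m (i - 1)).point X)) (code (z ⟨i - 1, h⟩))
  else codeVec ((window (2 ^ m) (2 ^ m - 1) 1).point X)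

/-- The claimed sum `∏ⱼ zⱼ S + ∑ⱼ (∏_{l > j} zₗ) yⱼ` of the final univariate polynomial, computed
from the alleged values. -/
def foldSum (m : ℕ) (z : Fin m → F) (S : F) (y : Fin (2 * m + 1) → F) : F :=
  (∏ j, z j) * S + ∑ j : Fin m, (∏ l ∈ Finset.univ.filter (fun l => j < l), z l) *
    y ⟨j.val, by omega⟩

/-- The consistency check of the alleged values at `β`, with `v` the value of `f` at `X`. -/
def foldConsistent (m : ℕ) (z : Fin m → F) (v : F) (y : Fin (2 * m + 1) → F) : Prop :=
  y ⟨2 * m, by omega⟩ = v + ∑ j : Fin m, z j * y ⟨m + j.val, by omega⟩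

/-- The univariate polynomial `g(x, 0, …, 0)`. -/
def toUnivariate {k d D : ℕ} (g : BPoly F k d D) : Polynomial F :=
  MvPolynomial.aeval (fun i : Fin k => if i.val = 0 then Polynomial.X else 0) g.1

variable {m d D : ℕ}

open Classical in
/-- The decision of the verifier of Fold-DCS (oracle access to `f`, claimed sum `S`), instantiated
with a polynomial commitment scheme and a univariate sumcheck, in interaction with the prover `P`.

The prover sends a commitment in each of the `m` rounds, a commitment to the final univariate
polynomial, and, once he knows `β`, the `2 m + 1` alleged values `y` together with the
polynomial `g` that stands behind the oracle of the univariate sumcheck, which has to open the last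
commitment. The alleged values are then checked by the batched evaluation protocol, and finally the
univariate sumcheck is run. The messages sent in the `m` rounds have to be commitments. -/
def foldDCS (pcs : PCS F (2 ^ m) d D) (US : USVerifier F) (P : PPT) (sec : ℕ)
    (f : BPoly F (2 ^ m) d D) (S : F) : PMF Bool :=
  (pcs.setup sec).bind fun pp =>
  (PMF.uniformOfFintype (Fin (2 ^ m) → F)).bind fun X =>
  (PMF.uniformOfFintype (Fin m → F)).bind fun z =>
  (talk (P.run sec) (fun h => foldMsg m X z h.length) (m + 2)
    (startState (Dat.cons pp (Dat.cons (codePoly f) (code S)))) []).bind fun r =>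
  let C : ℕ → Dat := fun j => r.2.getD j Dat.nil
  match decodeVec F (2 * m + 1) (C (m + 1)).hd, decodePoly F (2 ^ m) d D (C (m + 1)).tl with
  | some y, some g =>
      ((pcs.evalV (foldPlacement m) sec pp (foldCommitments m C) X y).interact
        (P.run sec) r.1).bind fun e =>
      ((US (toUnivariate g) (foldSum m z S y)).interact (P.run sec) e.2).map fun u =>
      decide ((∀ j < m, pcs.IsCommitment pp (C j)) ∧ pcs.opens pp g (C m) = true ∧
        foldConsistent m z (MvPolynomial.eval X f.1) y ∧ e.1 = true ∧ u.1 = true)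
  | _, _ => PMF.pure false

end

/-- `1 - (1 - ((D+1)/q - D/q²))ᵐ (1 - max(p, D/q) + σ)` plus `(m+1) ε`. -/
def soundnessBound (m D q : ℕ) (p ε σ : ℝ) : ℝ :=
  (m + 1) * ε + 1 -
    (1 - (((D : ℝ) + 1) / q - D / (q : ℝ) ^ 2)) ^ m * (1 - max p (D / q) + σ)

end

/-!
The field and the degrees are fixed while the security parameter grows, so there are only finitely
many claims `(f, S)`, coins of the verifier and polynomials. An adversary may have any of them
hard-wired, and a sum of negligible functions over all of them is negligible.

* Binding: the adversary replays the prover on hard-wired coins and outputs the commitment `C`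
  together with a hard-wired pair of polynomials. So, up to a negligible probability, the polynomial
  opened in step 4 is the one committed to in `C`.
* Batch evaluation binding: the adversary replays the prover and outputs the commitments, their
  true values and hard-wired false values. In the evaluation protocol its partner is honest on the
  true values and on the false ones runs the given prover afresh. As the commitments come from one
  run and the conversation from another, the success probability is squared (Jensen), and the square
  root of a negligible function is negligible. So, up to a negligible probability, the values sent
  are the true ones.

The prover is then bound in every round to a polynomial chosen before the coins of that round, and
soundness follows by induction on the rounds. The claim of a round is a sum over the coordinates
that are not fixed yet. A false claim becomes true in one round with probability at most `D / q` by
Schwartz-Zippel if the sum of the polynomial sent is the one that the prover claims implicitly, and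
at most `1 / q` otherwise, since the new claim is then a nontrivial linear equation for the scalar
`z`. This leaves nothing for `σ` to absorb.
-/

open scoped ENNReal

/-! ### Expectations with respect to probability mass functions -/

section Expectation

variable {α β : Type*}

theorem bind_congr_of_support {p : PMF α} {f g : α → PMF β} (h : ∀ a ∈ p.support, f a = g a) :
    p.bind f = p.bind g := by
  ext b
  simp only [PMF.bind_apply]
  refine tsum_congr fun a => ?_
  by_cases ha : p a = 0
  · simp [ha]
  · rw [h a ((p.mem_support_iff a).2 ha)]

/-- The expectation of a nonnegative function under a probability mass function, as an extended
nonnegative real, so that it exists without summability conditions. -/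
noncomputable def expec (p : PMF α) (φ : α → ℝ≥0∞) : ℝ≥0∞ := ∑' a, p a * φ a

theorem expec_pure (a : α) (φ : α → ℝ≥0∞) : expec (PMF.pure a) φ = φ a := by
  classical
  rw [expec, tsum_eq_single a fun b hb => by simp [PMF.pure_apply_of_ne _ _ hb]]
  simp

theorem expec_bind (p : PMF α) (f : α → PMF β) (φ : β → ℝ≥0∞) :
    expec (p.bind f) φ = expec p fun a => expec (f a) φ := by
  simp only [expec, PMF.bind_apply, ← ENNReal.tsum_mul_right, ← ENNReal.tsum_mul_left]
  rw [ENNReal.tsum_comm]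
  simp only [mul_assoc]

theorem expec_map (p : PMF α) (f : α → β) (φ : β → ℝ≥0∞) :
    expec (p.map f) φ = expec p fun a => φ (f a) := by
  simp [PMF.map, expec_bind, expec_pure]

theorem expec_mono_of_support {p : PMF α} {φ ψ : α → ℝ≥0∞} (h : ∀ a ∈ p.support, φ a ≤ ψ a) :
    expec p φ ≤ expec p ψ := by
  refine ENNReal.tsum_le_tsum fun a => ?_
  by_cases ha : p a = 0
  · simp [ha]
  · gcongr
    exact h a ((p.mem_support_iff a).2 ha)

theorem expec_congr_of_support {p : PMF α} {φ ψ : α → ℝ≥0∞} (h : ∀ a ∈ p.support, φ a = ψ a) :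
    expec p φ = expec p ψ :=
  le_antisymm (expec_mono_of_support fun a ha => (h a ha).le)
    (expec_mono_of_support fun a ha => (h a ha).ge)

theorem expec_mono {p : PMF α} {φ ψ : α → ℝ≥0∞} (h : ∀ a, φ a ≤ ψ a) : expec p φ ≤ expec p ψ :=
  expec_mono_of_support fun a _ => h a

theorem expec_const (p : PMF α) (c : ℝ≥0∞) : expec p (fun _ => c) = c := by
  simp [expec, ENNReal.tsum_mul_right, p.tsum_coe]

theorem expec_le {p : PMF α} {φ : α → ℝ≥0∞} {c : ℝ≥0∞} (h : ∀ a, φ a ≤ c) : expec p φ ≤ c :=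
  (expec_mono h).trans_eq (expec_const p c)

theorem expec_add (p : PMF α) (φ ψ : α → ℝ≥0∞) :
    expec p (fun a => φ a + ψ a) = expec p φ + expec p ψ := by
  simp [expec, mul_add, ENNReal.tsum_add]

theorem expec_mul_const (p : PMF α) (φ : α → ℝ≥0∞) (c : ℝ≥0∞) :
    expec p (fun a => φ a * c) = expec p φ * c := by
  simp [expec, ← mul_assoc, ENNReal.tsum_mul_right]

theorem expec_const_mul (p : PMF α) (φ : α → ℝ≥0∞) (c : ℝ≥0∞) :
    expec p (fun a => c * φ a) = c * expec p φ := by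
  simp only [mul_comm c, expec_mul_const]

theorem expec_finset_sum {ι : Type*} (s : Finset ι) (p : PMF α) (φ : ι → α → ℝ≥0∞) :
    expec p (fun a => ∑ i ∈ s, φ i a) = ∑ i ∈ s, expec p (φ i) := by
  simp only [expec, Finset.mul_sum]
  exact Summable.tsum_finsetSum fun _ _ => ENNReal.summable

theorem expec_comm (p : PMF α) (q : PMF β) (φ : α → β → ℝ≥0∞) :
    expec p (fun a => expec q (φ a)) = expec q fun b => expec p fun a => φ a b := by
  simp only [expec, ← ENNReal.tsum_mul_left]
  rw [ENNReal.tsum_comm]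
  simp only [mul_left_comm]

theorem expec_uniform [Fintype α] [Nonempty α] (φ : α → ℝ≥0∞) :
    expec (PMF.uniformOfFintype α) φ = (Fintype.card α : ℝ≥0∞)⁻¹ * ∑ a, φ a := by
  simp [expec, tsum_fintype, Finset.mul_sum]

theorem expec_uniform_le_sum [Fintype α] [Nonempty α] (φ : α → ℝ≥0∞) :
    expec (PMF.uniformOfFintype α) φ ≤ ∑ a, φ a := by
  rw [expec_uniform]
  refine mul_le_of_le_one_left' (ENNReal.inv_le_one.2 ?_)
  exact_mod_cast Fintype.card_pos

/-- Expanding the square of the expectation as a double expectation reduces this to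
`2 * a * b ≤ a ^ 2 + b ^ 2`. -/
theorem sq_expec_le_expec_sq (p : PMF α) (φ : α → ℝ≥0∞) :
    expec p φ ^ 2 ≤ expec p fun a => φ a ^ 2 := by
  have two_mul_le (a b : ℝ≥0∞) : 2 * (a * b) ≤ a ^ 2 + b ^ 2 := by
    rcases eq_or_ne a ⊤ with rfl | ha
    · simp
    rcases eq_or_ne b ⊤ with rfl | hb
    · simp
    lift a to NNReal using ha
    lift b to NNReal using hb
    norm_cast
    simpa only [mul_assoc] using two_mul_le_add_sq a b
  have h : 2 * expec p φ ^ 2 ≤ 2 * expec p fun a => φ a ^ 2 := by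
    calc 2 * expec p φ ^ 2 = expec p fun a => expec p fun b => 2 * (φ a * φ b) := by
          simp only [expec_const_mul, expec_mul_const, sq]
      _ ≤ expec p fun a => expec p fun b => φ a ^ 2 + φ b ^ 2 :=
          expec_mono fun a => expec_mono fun b => two_mul_le _ _
      _ = 2 * expec p fun a => φ a ^ 2 := by
          simp only [expec_add, expec_const, two_mul]
  exact (ENNReal.mul_le_mul_iff_right (by simp) (by simp)).1 h

theorem apply_true_eq_expec (q : PMF Bool) :
    q true = expec q fun b => if b = true then 1 else 0 := by
  simp [expec]

theorem bind_apply_true (p : PMF α) (q : α → PMF Bool) :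
    p.bind q true = expec p fun a => q a true :=
  PMF.bind_apply p q true

theorem map_decide_apply_true (p : PMF α) (A : α → Prop) [DecidablePred A] :
    (p.map fun a => decide (A a)) true = expec p fun a => if A a then 1 else 0 := by
  simp only [apply_true_eq_expec, expec_map, decide_eq_true_eq]

theorem bind_map_decide_and_apply_true (q q' : PMF Bool) :
    (q.bind fun b => q'.map fun b' => decide (b = true ∧ b' = true)) true = q true * q' true := by
  rw [bind_apply_true, apply_true_eq_expec q, ← expec_mul_const]
  refine congrArg _ (funext fun b => ?_)
  cases b <;> simp [apply_true_eq_expec q']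

theorem ofReal_prob (q : PMF Bool) : ENNReal.ofReal (prob q) = q true :=
  ENNReal.ofReal_toReal (q.apply_ne_top true)

theorem prob_le_one (q : PMF Bool) : prob q ≤ 1 :=
  ENNReal.toReal_mono ENNReal.one_ne_top (q.coe_le_one true)

end Expectation

/-! ### Negligible functions -/

theorem Negligible.zero : Negligible fun _ => 0 := by
  refine fun c _ => ⟨1, fun n hn => ?_⟩
  have : (0 : ℝ) < n := by exact_mod_cast hn
  rw [abs_zero]
  positivity

theorem Negligible.add {f g : ℕ → ℝ} (hf : Negligible f) (hg : Negligible g) :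
    Negligible fun n => f n + g n := by
  intro c _
  obtain ⟨N, hN⟩ := hf (c + 1) (by omega)
  obtain ⟨M, hM⟩ := hg (c + 1) (by omega)
  refine ⟨max 2 (max N M), fun n hn => ?_⟩
  have two_le : (2 : ℝ) ≤ n := by exact_mod_cast (le_max_left _ _).trans hn
  have pow_succ_eq : (n : ℝ) ^ (-(c : ℤ)) = n * (n : ℝ) ^ (-((c + 1 : ℕ) : ℤ)) := by
    rw [← zpow_one_add₀ (by positivity)]
    congr 1
    push_cast
    ring
  calc |f n + g n| ≤ |f n| + |g n| := abs_add_le _ _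
    _ < 2 * (n : ℝ) ^ (-((c + 1 : ℕ) : ℤ)) := by linarith [hN n (by omega), hM n (by omega)]
    _ ≤ (n : ℝ) ^ (-(c : ℤ)) := by rw [pow_succ_eq]; gcongr

theorem Negligible.sqrt {f : ℕ → ℝ} (hf : Negligible f) : Negligible fun n => √(f n) := by
  intro c hc
  obtain ⟨N, hN⟩ := hf (2 * c) (by omega)
  refine ⟨max 1 N, fun n hn => ?_⟩
  have n_pos : (0 : ℝ) < n := by exact_mod_cast (le_max_left 1 N).trans hn
  rw [abs_of_nonneg (Real.sqrt_nonneg _), Real.sqrt_lt' (by positivity)]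
  refine (le_abs_self _).trans_lt ((hN n (by omega)).trans_eq ?_)
  rw [← zpow_natCast, ← zpow_mul]
  congr 1
  push_cast
  ring

/-- A function with values in the extended nonnegative reals that is dominated by a negligible
one. -/
def ENegligible (f : ℕ → ℝ≥0∞) : Prop :=
  ∃ g : ℕ → ℝ, Negligible g ∧ (∀ n, 0 ≤ g n) ∧ ∀ n, f n ≤ ENNReal.ofReal (g n)

theorem eNegligible_apply_true {q : ℕ → PMF Bool} (h : Negligible fun n => prob (q n)) :
    ENegligible fun n => q n true :=
  ⟨_, h, fun _ => ENNReal.toReal_nonneg, fun n => (ofReal_prob (q n)).ge⟩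

namespace ENegligible

theorem zero : ENegligible fun _ => 0 := ⟨_, Negligible.zero, fun _ => le_rfl, by simp⟩

theorem mono {f g : ℕ → ℝ≥0∞} (hg : ENegligible g) (h : ∀ n, f n ≤ g n) : ENegligible f :=
  let ⟨b, hb, hb₀, hgb⟩ := hg
  ⟨b, hb, hb₀, fun n => (h n).trans (hgb n)⟩

theorem add {f g : ℕ → ℝ≥0∞} (hf : ENegligible f) (hg : ENegligible g) :
    ENegligible fun n => f n + g n := by
  obtain ⟨a, ha, ha₀, hfa⟩ := hf
  obtain ⟨b, hb, hb₀, hgb⟩ := hg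
  refine ⟨_, ha.add hb, fun n => add_nonneg (ha₀ n) (hb₀ n), fun n => ?_⟩
  rw [ENNReal.ofReal_add (ha₀ n) (hb₀ n)]
  exact add_le_add (hfa n) (hgb n)

theorem sum {ι : Type*} {s : Finset ι} {f : ι → ℕ → ℝ≥0∞} (h : ∀ i ∈ s, ENegligible (f i)) :
    ENegligible fun n => ∑ i ∈ s, f i n := by
  classical
  induction s using Finset.induction_on with
  | empty => simpa using zero
  | insert i s hi ih =>
    simp only [Finset.sum_insert hi]
    exact (h i (by simp)).add (ih fun j hj => h j (by simp [hj]))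

theorem of_sq_le {f g : ℕ → ℝ≥0∞} (hg : ENegligible g) (h : ∀ n, f n ^ 2 ≤ g n) :
    ENegligible f := by
  obtain ⟨b, hb, hb₀, hgb⟩ := hg
  refine ⟨_, hb.sqrt, fun n => Real.sqrt_nonneg _, fun n => ?_⟩
  rw [← ENNReal.pow_le_pow_left_iff two_ne_zero, ← ENNReal.ofReal_pow (Real.sqrt_nonneg _),
    Real.sq_sqrt (hb₀ n)]
  exact (h n).trans (hgb n)

theorem expec_uniform {α : Type*} [Fintype α] [Nonempty α] {f : α → ℕ → ℝ≥0∞}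
    (h : ∀ a, ENegligible (f a)) :
    ENegligible fun n => expec (PMF.uniformOfFintype α) fun a => f a n :=
  (sum fun a _ => h a).mono fun _ => expec_uniform_le_sum _

theorem exists_uniform_bound {ι : Type*} [Finite ι] {f : ι → ℕ → ℝ≥0∞}
    (h : ∀ i, ENegligible (f i)) :
    ∃ g : ℕ → ℝ, Negligible g ∧ (∀ n, 0 ≤ g n) ∧ ∀ i n, f i n ≤ ENNReal.ofReal (g n) := by
  cases nonempty_fintype ι
  obtain ⟨g, hg, hg₀, hfg⟩ := sum (s := Finset.univ) fun i _ => h i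
  exact ⟨g, hg, hg₀, fun i n =>
    (Finset.single_le_sum (f := fun i => f i n) (fun _ _ => zero_le) (Finset.mem_univ i)).trans
      (hfg n)⟩

end ENegligible

/-! ### Efficiently computable randomised functions -/

namespace Prog

theorem mem_support_andThen {r : Res} {k : Dat → ℕ → Res} {o : Option (Dat × ℕ)} :
    o ∈ (andThen r k).support ↔
      (none ∈ r.support ∧ o = none) ∨ ∃ y t, some (y, t) ∈ r.support ∧ o ∈ (k y t).support := by
  rw [andThen, PMF.mem_support_bind_iff]
  constructor
  · rintro ⟨_ | ⟨y, t⟩, ha, ho⟩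
    · exact Or.inl ⟨ha, by simpa using ho⟩
    · exact Or.inr ⟨y, t, ha, ho⟩
  · rintro (⟨h, rfl⟩ | ⟨y, t, h, ho⟩)
    · exact ⟨none, h, by simp⟩
    · exact ⟨some (y, t), h, ho⟩

theorem andThen_congr {r r' : Res} {k k' : Dat → ℕ → Res} (hn : none ∉ (andThen r k).support)
    (hr : none ∉ r.support → r' = r)
    (hk : ∀ y t, none ∉ (k y t).support → k' y t = k y t) : andThen r' k' = andThen r k := by
  rw [hr fun h => hn (mem_support_andThen.2 (Or.inl ⟨h, rfl⟩))]
  refine bind_congr_of_support fun o ho => ?_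
  rcases o with _ | ⟨y, t⟩
  · rfl
  · exact hk y t fun h => hn (mem_support_andThen.2 (Or.inr ⟨y, t, ho, h⟩))

theorem loopExec_eq_of_le {b b' : Dat → Res} (hb : ∀ x, none ∉ (b x).support → b' x = b x) :
    ∀ {N N' : ℕ}, N ≤ N' → ∀ x t, none ∉ (loopExec b N x t).support →
      loopExec b' N' x t = loopExec b N x t
  | _, _, _, Dat.nil, t, _ => by simp [loopExec]
  | _, _, _, Dat.cons Dat.nil y, t, _ => by simp [loopExec]
  | 0, _, _, Dat.cons (Dat.cons _ _) _, t, h => by simp [loopExec] at h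
  | N + 1, N' + 1, hN, Dat.cons (Dat.cons u v) y, t, h => by
    rw [loopExec] at h ⊢
    rw [loopExec]
    exact andThen_congr h (hb _) fun x' s hs =>
      loopExec_eq_of_le hb (Nat.le_of_succ_le_succ hN) x' _ hs

theorem exec_eq_of_le {N N' : ℕ} (hN : N ≤ N') :
    ∀ (p : Prog) (x : Dat), none ∉ (exec N p x).support → exec N' p x = exec N p x
  | id, x, _ => rfl
  | nil, x, _ => rfl
  | hd, x, _ => rfl
  | tl, x, _ => rfl
  | rand _, x, _ => rfl
  | pair p q, x, h => by
    rw [exec] at h ⊢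
    rw [exec]
    exact andThen_congr h (exec_eq_of_le hN p x) fun y s h' =>
      andThen_congr h' (exec_eq_of_le hN q x) fun _ _ _ => rfl
  | comp q p, x, h => by
    rw [exec] at h ⊢
    rw [exec]
    exact andThen_congr h (exec_eq_of_le hN p x) fun y s h' =>
      andThen_congr h' (exec_eq_of_le hN q y) fun _ _ _ => rfl
  | cond c p q, x, h => by
    rw [exec] at h ⊢
    rw [exec]
    refine andThen_congr h (exec_eq_of_le hN c x) fun y s h' => ?_
    cases y with
    | nil => exact andThen_congr h' (exec_eq_of_le hN q x) fun _ _ _ => rfl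
    | cons => exact andThen_congr h' (exec_eq_of_le hN p x) fun _ _ _ => rfl
  | loop b, x, h => by
    rw [exec] at h ⊢
    rw [exec]
    exact loopExec_eq_of_le (exec_eq_of_le hN b) hN x 0 h

/-- The value of the outcome of an execution, `nil` if it was cut off (as in `PPT.run`). -/
def value (o : Option (Dat × ℕ)) : Dat := (o.map Prod.fst).getD Dat.nil

/-- The execution `r` always finishes within `B` steps, and its value has the distribution `μ`. -/
def HasLaw (r : Res) (B : ℕ) (μ : PMF Dat) : Prop :=
  (∀ o ∈ r.support, ∃ y t, o = some (y, t) ∧ t ≤ B) ∧ r.map value = μ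

theorem hasLaw_ret {y : Dat} {t B : ℕ} (h : t ≤ B) : HasLaw (ret y t) B (PMF.pure y) := by
  refine ⟨fun o ho => ?_, PMF.pure_map _ _⟩
  rw [ret, PMF.mem_support_pure_iff] at ho
  exact ⟨y, t, ho, h⟩

namespace HasLaw

theorem none_notMem_support {r : Res} {B : ℕ} {μ : PMF Dat} (h : HasLaw r B μ) :
    none ∉ r.support := fun hn => by
  obtain ⟨_, _, h, _⟩ := h.1 _ hn
  simp at h

theorem mono {r : Res} {B B' : ℕ} {μ : PMF Dat} (h : HasLaw r B μ) (hB : B ≤ B') :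
    HasLaw r B' μ :=
  ⟨fun o ho => let ⟨y, t, ho, ht⟩ := h.1 o ho; ⟨y, t, ho, ht.trans hB⟩, h.2⟩

theorem andThen {r : Res} {B B' : ℕ} {μ : PMF Dat} {k : Dat → ℕ → Res} {ν : Dat → PMF Dat}
    (hr : HasLaw r B μ) (hk : ∀ y ∈ μ.support, ∀ t ≤ B, HasLaw (k y t) B' (ν y)) :
    HasLaw (andThen r k) B' (μ.bind ν) := by
  have hk' {y : Dat} {t : ℕ} (h : some (y, t) ∈ r.support) : HasLaw (k y t) B' (ν y) := by
    obtain ⟨y', t', h', ht⟩ := hr.1 _ h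
    obtain ⟨rfl, rfl⟩ : y = y' ∧ t = t' := by simpa using h'
    exact hk y (hr.2 ▸ (PMF.mem_support_map_iff _ _ _).2 ⟨_, h, rfl⟩) t ht
  refine ⟨fun o ho => ?_, ?_⟩
  · rcases mem_support_andThen.1 ho with ⟨hn, _⟩ | ⟨y, t, hs, ho⟩
    · exact absurd hn hr.none_notMem_support
    · exact (hk' hs).1 o ho
  · rw [← hr.2, Prog.andThen, PMF.map_bind, PMF.bind_map]
    refine bind_congr_of_support fun o ho => ?_
    obtain ⟨y, t, rfl, -⟩ := hr.1 o ho
    exact (hk' ho).2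

theorem andThen_ret {r : Res} {B s c : ℕ} {μ : PMF Dat} (hr : HasLaw r B μ) (φ : Dat → Dat)
    (hs : s ≤ c) : HasLaw (Prog.andThen r fun z t => ret (φ z) (s + t + 1)) (c + B + 1)
      (μ.map φ) :=
  hr.andThen fun _ _ _ ht => hasLaw_ret (by omega)

variable {N B B' : ℕ} {p q : Prog} {x : Dat} {μ : PMF Dat}

theorem comp {ν : Dat → PMF Dat} (hp : HasLaw (p.exec N x) B μ)
    (hq : ∀ y ∈ μ.support, HasLaw (q.exec N y) B' (ν y)) :
    HasLaw ((Prog.comp q p).exec N x) (B + B' + 1) (μ.bind ν) := by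
  rw [exec]
  refine hp.andThen fun y hy s hs => ?_
  simpa only [id_eq, PMF.map_id] using (hq y hy).andThen_ret _root_.id hs

theorem pair {ν : PMF Dat} (hp : HasLaw (p.exec N x) B μ) (hq : HasLaw (q.exec N x) B' ν) :
    HasLaw ((Prog.pair p q).exec N x) (B + B' + 1) (μ.bind fun y => ν.map (Dat.cons y)) := by
  rw [exec]
  exact hp.andThen fun y _ s hs => hq.andThen_ret (Dat.cons y) hs

open Classical in
theorem cond {c : Prog} {y : Dat} {C : ℕ} {ν : PMF Dat} (hc : HasLaw (c.exec N x) C (PMF.pure y))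
    (hp : HasLaw (p.exec N x) B μ) (hq : HasLaw (q.exec N x) B' ν) :
    HasLaw ((Prog.cond c p q).exec N x) (C + (B + B') + 1) (if y = Dat.nil then ν else μ) := by
  rw [exec, ← PMF.pure_bind y fun y => if y = Dat.nil then ν else μ]
  refine hc.andThen fun y _ s hs => ?_
  cases y with
  | nil =>
    simpa only [id_eq, PMF.map_id, if_pos] using
      (hq.mono (Nat.le_add_left _ B)).andThen_ret _root_.id hs
  | cons =>
    simpa only [id_eq, PMF.map_id, reduceCtorEq, if_false] using
      (hp.mono (Nat.le_add_right _ B')).andThen_ret _root_.id hs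

end HasLaw

end Prog

/-- A randomised function of the security parameter and a tree that is the output distribution of
a probabilistic polynomial-time algorithm. -/
def Efficient (g : ℕ → Dat → PMF Dat) : Prop := ∃ A : PPT, ∀ sec x, A.run sec x = g sec x

/-- A deterministic function on trees that is computed by a probabilistic polynomial-time
algorithm. -/
def EfficientDet (φ : Dat → Dat) : Prop := Efficient fun _ x => PMF.pure (φ x)

theorem PPT.efficient (A : PPT) : Efficient A.run := ⟨A, fun _ _ => rfl⟩

theorem PPT.hasLaw (A : PPT) (sec : ℕ) (x : Dat) {N : ℕ} (hN : A.bound.eval sec ≤ N) :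
    Prog.HasLaw (A.code.exec N (Dat.cons (Dat.num sec) x)) (A.bound.eval sec) (A.run sec x) := by
  have h : Prog.HasLaw (A.code.exec (A.bound.eval sec) (Dat.cons (Dat.num sec) x))
    (A.bound.eval sec) (A.run sec x) := ⟨A.halts sec x, rfl⟩
  rwa [Prog.exec_eq_of_le hN _ _ h.none_notMem_support]

theorem efficient_of_hasLaw {g : ℕ → Dat → PMF Dat} (p : Prog) (B : Polynomial ℕ)
    (h : ∀ sec x N, B.eval sec ≤ N →
      Prog.HasLaw (p.exec N (Dat.cons (Dat.num sec) x)) (B.eval sec) (g sec x)) :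
    Efficient g :=
  ⟨⟨p, B, fun sec x => (h sec x _ le_rfl).1⟩, fun sec x => (h sec x _ le_rfl).2⟩

theorem efficientDet_id : EfficientDet fun x => x :=
  efficient_of_hasLaw Prog.tl 1 fun _ x _ _ => Prog.hasLaw_ret (y := x) (by simp)

theorem efficientDet_nil : EfficientDet fun _ => Dat.nil :=
  efficient_of_hasLaw Prog.nil 1 fun _ _ _ _ => Prog.hasLaw_ret (by simp)

theorem efficientDet_hd : EfficientDet Dat.hd := by
  refine efficient_of_hasLaw (Prog.comp Prog.hd Prog.tl) (1 + 1 + 1) fun sec x N _ => ?_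
  simpa only [PMF.pure_bind, Polynomial.eval_add, Polynomial.eval_one] using
    (Prog.hasLaw_ret (y := x) (le_refl 1)).comp (N := N) (p := Prog.tl)
      (x := Dat.cons (Dat.num sec) x) (q := Prog.hd) fun y _ => Prog.hasLaw_ret (le_refl 1)

theorem efficientDet_tl : EfficientDet Dat.tl := by
  refine efficient_of_hasLaw (Prog.comp Prog.tl Prog.tl) (1 + 1 + 1) fun sec x N _ => ?_
  simpa only [PMF.pure_bind, Polynomial.eval_add, Polynomial.eval_one] using
    (Prog.hasLaw_ret (y := x) (le_refl 1)).comp (N := N) (p := Prog.tl)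
      (x := Dat.cons (Dat.num sec) x) (q := Prog.tl) fun y _ => Prog.hasLaw_ret (le_refl 1)

namespace Efficient

theorem congr {g h : ℕ → Dat → PMF Dat} (hg : Efficient g) (hgh : ∀ sec x, g sec x = h sec x) :
    Efficient h :=
  (funext₂ hgh : g = h) ▸ hg

/-- The second program needs the security parameter, so the first one is run in parallel with a
program that extracts it. -/
theorem comp {g h : ℕ → Dat → PMF Dat} (hg : Efficient g) (hh : Efficient h) :
    Efficient fun sec x => (g sec x).bind (h sec) := by
  obtain ⟨A, hA⟩ := hg
  obtain ⟨B, hB⟩ := hh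
  refine efficient_of_hasLaw (Prog.comp B.code (Prog.pair Prog.hd A.code))
    (1 + A.bound + 1 + B.bound + 1) fun sec x N hN => ?_
  simp only [Polynomial.eval_add, Polynomial.eval_one] at hN ⊢
  have pair_law : Prog.HasLaw ((Prog.pair Prog.hd A.code).exec N (Dat.cons (Dat.num sec) x))
      (1 + A.bound.eval sec + 1) ((g sec x).map (Dat.cons (Dat.num sec))) := by
    rw [← hA, ← PMF.pure_bind (Dat.num sec) fun s => (A.run sec x).map (Dat.cons s)]
    exact Prog.HasLaw.pair (p := Prog.hd) (Prog.hasLaw_ret le_rfl) (A.hasLaw sec x (by omega))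
  have bind_eq : (g sec x).bind (h sec) =
      ((g sec x).map (Dat.cons (Dat.num sec))).bind fun y => h sec y.tl := by
    rw [PMF.bind_map]
    rfl
  rw [bind_eq]
  refine pair_law.comp fun y hy => ?_
  obtain ⟨z, -, rfl⟩ := (PMF.mem_support_map_iff _ _ _).1 hy
  exact hB sec z ▸ B.hasLaw sec z (by omega)

theorem cons {g h : ℕ → Dat → PMF Dat} (hg : Efficient g) (hh : Efficient h) :
    Efficient fun sec x => (g sec x).bind fun y => (h sec x).map (Dat.cons y) := by
  obtain ⟨A, hA⟩ := hg
  obtain ⟨B, hB⟩ := hh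
  refine efficient_of_hasLaw (Prog.pair A.code B.code) (A.bound + B.bound + 1)
    fun sec x N hN => ?_
  simp only [Polynomial.eval_add, Polynomial.eval_one] at hN ⊢
  rw [← hA, ← hB]
  exact (A.hasLaw sec x (by omega)).pair (B.hasLaw sec x (by omega))

open Classical in
theorem ite_nil {φ : Dat → Dat} {g h : ℕ → Dat → PMF Dat} (hφ : EfficientDet φ)
    (hg : Efficient g) (hh : Efficient h) :
    Efficient fun sec x => if φ x = Dat.nil then g sec x else h sec x := by
  obtain ⟨T, hT⟩ := hφ
  obtain ⟨A, hA⟩ := hg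
  obtain ⟨B, hB⟩ := hh
  refine efficient_of_hasLaw (Prog.cond T.code B.code A.code)
    (T.bound + (B.bound + A.bound) + 1) fun sec x N hN => ?_
  simp only [Polynomial.eval_add, Polynomial.eval_one] at hN ⊢
  rw [← hA, ← hB]
  have test_law := T.hasLaw (N := N) sec x (by omega)
  rw [hT] at test_law
  exact test_law.cond (B.hasLaw sec x (by omega)) (A.hasLaw sec x (by omega))

theorem comp_det {φ : Dat → Dat} {h : ℕ → Dat → PMF Dat} (hh : Efficient h)
    (hφ : EfficientDet φ) : Efficient fun sec x => h sec (φ x) := by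
  simpa only [PMF.pure_bind] using Efficient.comp hφ hh

theorem map {g : ℕ → Dat → PMF Dat} {φ : Dat → Dat} (hg : Efficient g) (hφ : EfficientDet φ) :
    Efficient fun sec x => (g sec x).map φ :=
  hg.comp hφ

theorem bind {g h : ℕ → Dat → PMF Dat} (hg : Efficient g) (hh : Efficient h) :
    Efficient fun sec x => (g sec x).bind fun y => h sec (Dat.cons x y) := by
  simpa only [PMF.pure_bind, PMF.bind_map, Function.comp_def] using
    (Efficient.cons efficientDet_id hg).comp hh

end Efficient

namespace EfficientDet

theorem congr {φ ψ : Dat → Dat} (hφ : EfficientDet φ) (h : ∀ x, φ x = ψ x) : EfficientDet ψ :=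
  (funext h : φ = ψ) ▸ hφ

theorem comp {φ ψ : Dat → Dat} (hψ : EfficientDet ψ) (hφ : EfficientDet φ) :
    EfficientDet fun x => ψ (φ x) :=
  Efficient.comp_det (h := fun _ x => PMF.pure (ψ x)) hψ hφ

theorem cons {φ ψ : Dat → Dat} (hφ : EfficientDet φ) (hψ : EfficientDet ψ) :
    EfficientDet fun x => Dat.cons (φ x) (ψ x) :=
  (Efficient.cons hφ hψ).congr fun _ _ => by simp only [PMF.pure_bind, PMF.pure_map]

theorem hd {φ : Dat → Dat} (hφ : EfficientDet φ) : EfficientDet fun x => (φ x).hd :=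
  efficientDet_hd.comp hφ

theorem tl {φ : Dat → Dat} (hφ : EfficientDet φ) : EfficientDet fun x => (φ x).tl :=
  efficientDet_tl.comp hφ

theorem nth {φ : Dat → Dat} (hφ : EfficientDet φ) :
    ∀ i : ℕ, EfficientDet fun x => (φ x).nth i
  | 0 => hφ.hd
  | i + 1 => nth hφ.tl i

theorem ofList_ofFn : ∀ {n : ℕ} {φ : Fin n → Dat → Dat}, (∀ i, EfficientDet (φ i)) →
    EfficientDet fun x => Dat.ofList (List.ofFn fun i => φ i x)
  | 0, _, _ => efficientDet_nil
  | _ + 1, _, h => by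
    simpa only [List.ofFn_succ, Dat.ofList] using (h 0).cons (ofList_ofFn fun i => h i.succ)

open Classical in
theorem ite_nil {φ ψ χ : Dat → Dat} (hφ : EfficientDet φ) (hψ : EfficientDet ψ)
    (hχ : EfficientDet χ) : EfficientDet fun x => if φ x = Dat.nil then ψ x else χ x :=
  (Efficient.ite_nil hφ hψ hχ).congr fun _ _ => (apply_ite PMF.pure _ _ _).symm

end EfficientDet

theorem efficientDet_const : ∀ c : Dat, EfficientDet fun _ => c
  | Dat.nil => efficientDet_nil
  | Dat.cons a b => (efficientDet_const a).cons (efficientDet_const b)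

open Classical in
theorem efficientDet_ite_eq : ∀ c : Dat,
    EfficientDet fun x => if x = c then Dat.nil else Dat.cons Dat.nil Dat.nil
  | Dat.nil =>
    efficientDet_id.ite_nil efficientDet_nil (efficientDet_const (Dat.cons Dat.nil Dat.nil))
  | Dat.cons a b =>
    (efficientDet_id.ite_nil (efficientDet_const (Dat.cons Dat.nil Dat.nil))
      (((efficientDet_ite_eq a).comp efficientDet_hd).ite_nil
        ((efficientDet_ite_eq b).comp efficientDet_tl)
        (efficientDet_const (Dat.cons Dat.nil Dat.nil)))).congr fun x => by
      cases x with
      | nil => simp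
      | cons u v => by_cases hu : u = a <;> by_cases hv : v = b <;> simp [Dat.hd, Dat.tl, hu, hv]

open Classical in
theorem Efficient.ite_eq {φ : Dat → Dat} {g h : ℕ → Dat → PMF Dat} (hφ : EfficientDet φ)
    (c : Dat) (hg : Efficient g) (hh : Efficient h) :
    Efficient fun sec x => if φ x = c then g sec x else h sec x :=
  (Efficient.ite_nil ((efficientDet_ite_eq c).comp hφ) hg hh).congr fun _ x => by
    by_cases hc : φ x = c <;> simp [hc]

/-! ### Simulation of a conversation with fixed messages -/

theorem exists_replies_of_mem_support_talk {step : Dat → PMF Dat} {next : List Dat → Dat} :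
    ∀ {k : ℕ} {st : Dat} {h : List Dat} {r : Dat × List Dat},
      r ∈ (talk step next k st h).support → ∃ l : List Dat, l.length = k ∧ r.2 = h ++ l
  | 0, st, h, r, hr => by
    rw [talk, PMF.mem_support_pure_iff] at hr
    exact ⟨[], rfl, by rw [hr, List.append_nil]⟩
  | k + 1, st, h, r, hr => by
    rw [talk, PMF.mem_support_bind_iff] at hr
    obtain ⟨o, -, ho⟩ := hr
    obtain ⟨l, hl, hr⟩ := exists_replies_of_mem_support_talk ho
    exact ⟨o.tl :: l, by simp [hl], by simp [hr]⟩

theorem length_of_mem_support_talk {step : Dat → PMF Dat} {next : List Dat → Dat} {k : ℕ}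
    {st : Dat} {r : Dat × List Dat} (hr : r ∈ (talk step next k st []).support) :
    r.2.length = k := by
  obtain ⟨l, hl, hr⟩ := exists_replies_of_mem_support_talk hr
  rw [hr, List.nil_append, hl]

theorem talk_succ (step : Dat → PMF Dat) (next : List Dat → Dat) :
    ∀ (k : ℕ) (st : Dat) (h : List Dat), talk step next (k + 1) st h =
      (talk step next k st h).bind fun r =>
        (step (Dat.cons r.1 (next r.2))).map fun o => (o.hd, r.2 ++ [o.tl])
  | 0, st, h => by
    simp only [talk, PMF.pure_bind]
    rfl
  | k + 1, st, h => by
    rw [talk, talk, PMF.bind_bind]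
    exact congrArg _ (funext fun o => talk_succ step next k _ _)

/-- The final state and the replies of a conversation as a tree. The replies are listed latest
first, so that a new one is added at the root. -/
def encodeTalk (r : Dat × List Dat) : Dat := Dat.cons r.1 (Dat.ofList r.2.reverse)

theorem encodeTalk_append (s a : Dat) (h : List Dat) :
    encodeTalk (s, h ++ [a]) = Dat.cons s (Dat.cons a (Dat.ofList h.reverse)) := by
  simp [encodeTalk, Dat.ofList]

theorem efficient_talk (P : PPT) (msgs : ℕ → Dat) {φ : Dat → Dat} (hφ : EfficientDet φ) (k : ℕ) :
    Efficient fun sec x =>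
      (talk (P.run sec) (fun h => msgs h.length) k (φ x) []).map encodeTalk := by
  induction k with
  | zero =>
    simp only [talk, PMF.pure_map]
    exact hφ.cons efficientDet_nil
  | succ k ih =>
    have step_efficient : Efficient fun sec y =>
        (P.run sec (Dat.cons y.hd (msgs k))).bind fun o =>
          PMF.pure (Dat.cons o.hd (Dat.cons o.tl y.tl)) :=
      (P.efficient.comp_det (efficientDet_hd.cons (efficientDet_const _))).bind
        (h := fun _ w => PMF.pure (Dat.cons w.tl.hd (Dat.cons w.tl.tl w.hd.tl)))
        (efficientDet_tl.hd.cons (efficientDet_tl.tl.cons efficientDet_hd.tl))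
    refine (ih.comp step_efficient).congr fun sec x => ?_
    rw [talk_succ, PMF.map_bind, PMF.bind_map]
    refine bind_congr_of_support fun r hr => ?_
    rw [length_of_mem_support_talk hr, PMF.map_comp]
    simp only [Function.comp_def, encodeTalk_append]
    rfl

theorem Dat.nth_ofList : ∀ (l : List Dat) (i : ℕ), (Dat.ofList l).nth i = l.getD i Dat.nil
  | [], i => congrArg Dat.hd (Function.iterate_fixed rfl i)
  | _ :: _, 0 => rfl
  | _ :: l, i + 1 => Dat.nth_ofList l i

theorem Dat.nth_ofList_ofFn {n : ℕ} (φ : Fin n → Dat) (i : Fin n) :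
    (Dat.ofList (List.ofFn φ)).nth i = φ i := by
  simp [Dat.nth_ofList]

theorem nth_encodeTalk {r : Dat × List Dat} {k i : ℕ} (hr : r.2.length = k + 1) (hi : i ≤ k) :
    (encodeTalk r).tl.nth (k - i) = r.2.getD i Dat.nil := by
  rw [encodeTalk, Dat.tl, Dat.nth_ofList, List.getD_reverse _ (by omega)]
  congr 1
  omega

/-! ### Interactive algorithms that prepare a state and then follow one of two strategies -/

/-- The output of a step of an interactive algorithm, with a tag added to the new state. -/
def tagStep (tag o : Dat) : Dat := Dat.cons (Dat.cons tag o.hd) o.tl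

theorem efficientDet_tagStep (tag : Dat) : EfficientDet (tagStep tag) :=
  ((efficientDet_const tag).cons efficientDet_hd).cons efficientDet_tl

/-- On input `inp`, the strategy `step'` draws a state from `prep` and then behaves as `step` does
from this state; the states reached after the first step are marked by `tag`. -/
structure RunsPrepared (step' step : Dat → PMF Dat) (tag inp : Dat) (prep : PMF Dat) : Prop where
  start : ∀ msg, step' (Dat.cons (startState inp) msg) =
    prep.bind fun s => (step (Dat.cons s msg)).map (tagStep tag)
  step : ∀ s msg, step' (Dat.cons (Dat.cons tag s) msg) =
    (step (Dat.cons s msg)).map (tagStep tag)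

namespace RunsPrepared

variable {step' step : Dat → PMF Dat} {tag inp : Dat} {prep : PMF Dat}

theorem talk_tag (hQ : RunsPrepared step' step tag inp prep) (next : List Dat → Dat) :
    ∀ (k : ℕ) (s : Dat) (h : List Dat), talk step' next k (Dat.cons tag s) h =
      (talk step next k s h).map fun r => (Dat.cons tag r.1, r.2)
  | 0, s, h => by simp only [talk, PMF.pure_map]
  | k + 1, s, h => by
    rw [talk, talk, hQ.step, PMF.bind_map, PMF.map_bind]
    exact congrArg _ (funext fun o => hQ.talk_tag next k _ _)

theorem talk_startState (hQ : RunsPrepared step' step tag inp prep) (next : List Dat → Dat)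
    (k : ℕ) : (talk step' next k (startState inp) []).map Prod.snd =
      prep.bind fun s => (talk step next k s []).map Prod.snd := by
  cases k with
  | zero => simp [talk, PMF.pure_map]
  | succ k =>
    simp only [talk, hQ.start, PMF.bind_bind, PMF.map_bind, PMF.bind_map, Function.comp_apply,
      tagStep, Dat.hd, Dat.tl, hQ.talk_tag next, PMF.map_comp]
    rfl

theorem interact (hQ : RunsPrepared step' step tag inp prep) (V : Verifier) :
    (V.interact step' (startState inp)).map Prod.fst =
      prep.bind fun s => (V.interact step s).map Prod.fst := by
  have interact_eq (step : Dat → PMF Dat) (st : Dat) :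
      (V.interact step st).map Prod.fst = V.coins.bind fun w =>
        ((talk step (V.msg w) V.rounds st []).map Prod.snd).map (V.accept w) := by
    simp only [Verifier.interact, PMF.map_bind, PMF.map_comp]
    rfl
  simp only [interact_eq, hQ.talk_startState, PMF.map_bind]
  exact PMF.bind_comm _ _ _

end RunsPrepared

theorem Efficient.tagged_start {prep : ℕ → Dat → PMF Dat} (hprep : Efficient prep) (P : PPT)
    (tag : Dat) : Efficient fun sec w => (prep sec w.hd.tl).bind fun s =>
      (P.run sec (Dat.cons s w.tl)).map (tagStep tag) :=
  (hprep.comp_det efficientDet_hd.tl).bind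
    (h := fun sec v => (P.run sec (Dat.cons v.tl v.hd.tl)).map (tagStep tag))
    ((P.efficient.comp_det (efficientDet_tl.cons efficientDet_hd.tl)).map
      (efficientDet_tagStep tag))

theorem PPT.efficient_tagged (P : PPT) (tag : Dat) : Efficient fun sec w =>
    (P.run sec (Dat.cons w.hd.tl w.tl)).map (tagStep tag) :=
  (P.efficient.comp_det (efficientDet_hd.tl.cons efficientDet_tl)).map (efficientDet_tagStep tag)

open Classical in
theorem exists_dispatch {φ : Dat → Dat} (hφ : EfficientDet φ) (c : Dat)
    {prep₁ prep₂ : ℕ → Dat → PMF Dat} (h₁ : Efficient prep₁) (h₂ : Efficient prep₂)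
    (P₁ P₂ : PPT) : ∃ Q : PPT, ∀ (sec : ℕ) (V : Verifier) (inp : Dat),
      (V.interact (Q.run sec) (startState inp)).map Prod.fst =
        if φ inp = c then (prep₁ sec inp).bind fun s => (V.interact (P₁.run sec) s).map Prod.fst
        else (prep₂ sec inp).bind fun s => (V.interact (P₂.run sec) s).map Prod.fst := by
  -- `startState` has left subtree `nil`, so a nonempty tag tells later states from the first one.
  let tag₁ : Dat := Dat.num 1
  let tag₂ : Dat := Dat.num 2
  obtain ⟨Q, hQ⟩ := Efficient.ite_eq efficientDet_hd.hd Dat.nil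
    (Efficient.ite_eq (hφ.comp efficientDet_hd.tl) c (h₁.tagged_start P₁ tag₁)
      (h₂.tagged_start P₂ tag₂))
    (Efficient.ite_eq efficientDet_hd.hd tag₁ (P₁.efficient_tagged tag₁)
      (P₂.efficient_tagged tag₂))
  refine ⟨Q, fun sec V inp => ?_⟩
  split_ifs with hc
  · refine RunsPrepared.interact (tag := tag₁) ⟨fun msg => ?_, fun s msg => ?_⟩ V <;> rw [hQ] <;>
      simp [Dat.hd, Dat.tl, Dat.num, startState, hc, tag₁]
  · refine RunsPrepared.interact (tag := tag₂) ⟨fun msg => ?_, fun s msg => ?_⟩ V <;> rw [hQ] <;>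
      simp [Dat.hd, Dat.tl, Dat.num, startState, hc, tag₁, tag₂]

/-! ### Encodings -/

theorem Dat.num_injective : Function.Injective Dat.num
  | 0, 0, _ => rfl
  | 0, _ + 1, h | _ + 1, 0, h => by simp [Dat.num] at h
  | _ + 1, _ + 1, h => congrArg _ (Dat.num_injective (Dat.cons.inj h).2)

theorem code_injective {α : Type*} [Fintype α] : Function.Injective (code (α := α)) :=
  fun _ _ h => (Fintype.equivFin α).injective (Fin.ext (Dat.num_injective h))

theorem decodeVec_codeVec {F : Type*} [Fintype F] {k : ℕ} (x : Fin k → F) :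
    decodeVec F k (codeVec x) = some x :=
  Function.partialInv_left code_injective x

section

variable {F : Type*} [Field F] {k d D : ℕ}

theorem coeffTable_injective : Function.Injective fun (f : BPoly F k d D)
    (e : Fin k → Fin (d + 1)) =>
      f.1.coeff (Finsupp.equivFunOnFinite.symm fun i => (e i : ℕ)) := by
  intro f g h
  ext s
  by_cases hs : ∀ i, s i ≤ d
  · have coeff_eq := congrFun h fun i => ⟨s i, Nat.lt_succ_of_le (hs i)⟩
    have symm_eq : (Finsupp.equivFunOnFinite.symm fun i => s i) = s := by ext i; rfl
    simpa only [symm_eq] using coeff_eq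
  · push Not at hs
    obtain ⟨i, hi⟩ := hs
    have coeff_eq_zero (p : BPoly F k d D) : p.1.coeff s = 0 := by
      by_contra hne
      exact hi.not_ge ((MvPolynomial.monomial_le_degreeOf i
        (MvPolynomial.mem_support_iff.2 hne)).trans (p.2.1 i))
    rw [coeff_eq_zero, coeff_eq_zero]

instance BPoly.finite [Finite F] : Finite (BPoly F k d D) :=
  Finite.of_injective _ coeffTable_injective

noncomputable instance BPoly.fintype [Finite F] : Fintype (BPoly F k d D) := Fintype.ofFinite _

variable [Fintype F]

theorem codePoly_injective : Function.Injective (codePoly : BPoly F k d D → Dat) := fun _ _ h =>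
  coeffTable_injective (code_injective h)

theorem decodePoly_codePoly (f : BPoly F k d D) : decodePoly F k d D (codePoly f) = some f :=
  Function.partialInv_left codePoly_injective f

end

/-! ### Failures of the commitment scheme -/

namespace PCS

variable {F : Type*} [Field F] [Fintype F] {k d D ℓ : ℕ} (pcs : PCS F k d D)

/-- `C` is a commitment to two different polynomials. -/
def OpensTwice (pp C : Dat) : Prop := ∃ f g, f ≠ g ∧ C = pcs.commit pp f ∧ C = pcs.commit pp g

open Classical in
theorem Binding.eNegligible_opensTwice {pcs : PCS F k d D} (hbind : pcs.Binding)
    {T : ℕ → Dat → PMF Dat} (hT : Efficient T) :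
    ENegligible fun sec => expec (pcs.setup sec) fun pp => expec (T sec pp) fun C =>
      if pcs.OpensTwice pp C then 1 else 0 := by
  let opens (q : BPoly F k d D × BPoly F k d D) (pp C : Dat) : ℝ≥0∞ :=
    if C = pcs.commit pp q.1 ∧ C = pcs.commit pp q.2 then 1 else 0
  have eNegligible_pair (q : BPoly F k d D × BPoly F k d D) (hq : q.1 ≠ q.2) :
      ENegligible fun sec => expec (pcs.setup sec) fun pp => expec (T sec pp) (opens q pp) := by
    obtain ⟨A, hA⟩ := hT.map ((efficientDet_const (codePoly q.1)).cons
      ((efficientDet_const (codePoly q.2)).cons efficientDet_id))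
    refine (eNegligible_apply_true (hbind A)).mono fun sec => ?_
    rw [bind_apply_true]
    refine expec_mono fun pp => ?_
    rw [apply_true_eq_expec, expec_map, hA, expec_map]
    refine expec_mono fun C => ?_
    simp only [opens, decide_eq_true_eq, Dat.hd, Dat.tl, decodePoly_codePoly,
      pcs.opens_iff, Option.some.injEq]
    split_ifs with h h'
    · exact le_rfl
    · exact absurd ⟨_, _, rfl, rfl, hq, h⟩ h'
    · exact zero_le
    · exact le_rfl
  refine (ENegligible.sum (s := Finset.univ.filter fun q => q.1 ≠ q.2) fun q hq =>
    eNegligible_pair q (Finset.mem_filter.1 hq).2).mono fun sec => ?_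
  simp only [← expec_finset_sum]
  refine expec_mono fun pp => expec_mono fun C => ?_
  split_ifs with h
  · obtain ⟨f, g, hfg, hf, hg⟩ := h
    refine le_trans ?_ (Finset.single_le_sum (f := fun q => opens q pp C) (fun _ _ => zero_le)
      (Finset.mem_filter.2 ⟨Finset.mem_univ (f, g), hfg⟩))
    simp only [opens, if_pos (And.intro hf hg), le_refl]
  · exact zero_le

/-- The values of the polynomials `G` at the point `x`, with their variables placed by `π`. -/
noncomputable def values (π : Fin ℓ → Placement k) (x : Fin k → F) (G : Fin ℓ → BPoly F k d D) :
    Fin ℓ → F :=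
  fun i => MvPolynomial.eval ((π i).point x) (G i).1

variable (π : Fin ℓ → Placement k) (P : PPT)

/-- The probability that `P`, starting in the state `st`, convinces the evaluation verifier of the
values `y`. -/
noncomputable def convinceProb (sec : ℕ) (pp st : Dat) (C : Fin ℓ → Dat) (x : Fin k → F)
    (y : Fin ℓ → F) : ℝ≥0∞ :=
  ((pcs.evalV π sec pp C x y).interact (P.run sec) st).map Prod.fst true

open Classical in
/-- The total probability, over all tuples of false values of the polynomials committed to in `C`,
that `P` convinces the evaluation verifier of them. The sum over `G` accounts for commitments that
open in several ways. -/
noncomputable def falseEval (sec : ℕ) (pp st : Dat) (C : Fin ℓ → Dat) (x : Fin k → F) : ℝ≥0∞ :=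
  ∑ q : (Fin ℓ → BPoly F k d D) × (Fin ℓ → F) with q.2 ≠ values π x q.1,
    if ∀ i, C i = pcs.commit pp (q.1 i) then pcs.convinceProb π P sec pp st C x q.2 else 0

open Classical in
/-- The prover is honest on the true values. On all other input he runs the algorithm `T` again and
continues as `P`. -/
theorem exists_evalProver {T : ℕ → Dat → PMF Dat} (hT : Efficient T) {x : Fin k → F}
    {y : Fin ℓ → F} {G : Fin ℓ → BPoly F k d D} (hy : y ≠ values π x G) :
    ∃ Q : PPT, ∀ sec, ∀ pp ∈ (pcs.setup sec).support,
      pcs.evalGame π Q sec pp (fun i => pcs.commit pp (G i)) x (values π x G) true = 1 ∧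
      pcs.evalGame π Q sec pp (fun i => pcs.commit pp (G i)) x y true =
        expec (T sec pp) fun t =>
          pcs.convinceProb π P sec pp t.hd (fun i => pcs.commit pp (G i)) x y := by
  obtain ⟨Q, hQ⟩ := exists_dispatch efficientDet_id.tl.tl.tl (codeVec (values π x G))
    (prep₁ := fun _ inp =>
      PMF.pure (startState (Dat.cons (Dat.ofList (List.ofFn fun i => codePoly (G i))) inp)))
    (efficientDet_nil.cons ((efficientDet_const _).cons efficientDet_id))
    ((hT.comp_det efficientDet_hd).map efficientDet_hd) (pcs.evalP π) P
  refine ⟨Q, fun sec pp hpp => ⟨?_, ?_⟩⟩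
  · rw [evalGame, hQ]
    simp only [Dat.tl, if_true, PMF.pure_bind]
    have complete := pcs.complete π sec pp hpp G x _ (values π x G) (fun _ => rfl) fun _ => rfl
    rwa [Verifier.acceptProb, prob, ENNReal.toReal_eq_one_iff] at complete
  · rw [evalGame, hQ]
    have ne_values (c : Dat) :
        (Dat.cons pp (Dat.cons c (Dat.cons (codeVec x) (codeVec y)))).tl.tl.tl ≠
          codeVec (values π x G) := fun h => hy (code_injective h)
    rw [if_neg (ne_values _), bind_apply_true, expec_map]
    rfl

/-- The adversary outputs the true values and the values `y`. The event that `T` produces the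
commitments and the event that the prover, running `T` again, convinces the verifier of `y` are
independent, so that the probability `w` in question appears squared. -/
theorem BatchEvalBinding.eNegligible_convinceProb [DecidableEq Dat] {pcs : PCS F k d D}
    {π : Fin ℓ → Placement k} (heval : pcs.BatchEvalBinding π) {T : ℕ → Dat → PMF Dat}
    (hT : Efficient T) (P : PPT) {x : Fin k → F} {y : Fin ℓ → F} {G : Fin ℓ → BPoly F k d D}
    (hy : y ≠ values π x G) :
    ENegligible fun sec => expec (pcs.setup sec) fun pp => expec (T sec pp) fun t =>
      if ∀ i : Fin ℓ, t.tl.nth i = pcs.commit pp (G i) then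
        pcs.convinceProb π P sec pp t.hd (fun i => t.tl.nth i) x y else 0 := by
  obtain ⟨Q, hQ⟩ := pcs.exists_evalProver π P hT hy
  obtain ⟨A, hA⟩ := hT.map (efficientDet_tl.cons (efficientDet_const
    (Dat.ofList [codeVec x, codeVec (values π x G), codeVec y])))
  refine (eNegligible_apply_true (heval A Q)).of_sq_le fun sec => ?_
  refine (sq_expec_le_expec_sq _ _).trans ?_
  rw [bind_apply_true]
  refine expec_mono_of_support fun pp hpp => ?_
  obtain ⟨accept_true, accept_false⟩ := hQ sec pp hpp
  set w := expec (T sec pp) fun t => if ∀ i : Fin ℓ, t.tl.nth i = pcs.commit pp (G i) then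
    pcs.convinceProb π P sec pp t.hd (fun i => t.tl.nth i) x y else 0
  have w_le : w ≤ pcs.evalGame π Q sec pp (fun i => pcs.commit pp (G i)) x y true := by
    rw [accept_false]
    refine expec_mono fun t => ?_
    split_ifs with h
    · simp only [h, le_refl]
    · exact zero_le
  calc w ^ 2 ≤ (expec (T sec pp) fun t =>
          if ∀ i : Fin ℓ, t.tl.nth i = pcs.commit pp (G i) then 1 else 0) * w := by
        rw [sq]
        refine mul_le_mul_left (expec_mono fun t => ?_) w
        split_ifs
        · exact PMF.coe_le_one _ _
        · exact le_rfl
    _ ≤ _ := by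
        rw [← expec_mul_const, bind_apply_true, hA, expec_map]
        refine expec_mono fun t => ?_
        split_ifs with h
        · have nth_eq (a b c e : Dat) : (Dat.cons a (Dat.ofList [b, c, e])).nth 1 = b ∧
            (Dat.cons a (Dat.ofList [b, c, e])).nth 2 = c ∧
            (Dat.cons a (Dat.ofList [b, c, e])).nth 3 = e := ⟨rfl, rfl, rfl⟩
          simp only [Dat.hd, nth_eq, decodeVec_codeVec, h, Function.ne_iff.1 hy.symm, true_and,
            bind_map_decide_and_apply_true, accept_true, one_mul, w_le]
        · simp

theorem BatchEvalBinding.eNegligible_falseEval {pcs : PCS F k d D} {π : Fin ℓ → Placement k}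
    (heval : pcs.BatchEvalBinding π) {T : ℕ → Dat → PMF Dat} (hT : Efficient T) (P : PPT)
    (x : Fin k → F) :
    ENegligible fun sec => expec (pcs.setup sec) fun pp => expec (T sec pp) fun t =>
      pcs.falseEval π P sec pp t.hd (fun i => t.tl.nth i) x := by
  classical
  simp only [falseEval, expec_finset_sum]
  exact ENegligible.sum fun q hq =>
    heval.eNegligible_convinceProb hT P (Finset.mem_filter.1 hq).2

end PCS

/-! ### Resampling of random points -/

section

variable {F : Type*} {k : ℕ}

/-- The point with the coordinates of `X` before `s` and those of `Y` from `s` on. -/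
def splice (s : ℕ) (X Y : Fin k → F) : Fin k → F := fun i => if i.val < s then X i else Y i

theorem splice_splice_right {s s' : ℕ} (h : s ≤ s') (X W Y : Fin k → F) :
    splice s X (splice s' W Y) = splice s' (splice s X W) Y := by
  funext i
  unfold splice
  split_ifs <;> first | rfl | omega

theorem splice_splice_left (s : ℕ) (X W Y : Fin k → F) :
    splice s (splice s X W) Y = splice s X Y := by
  funext i
  unfold splice
  split_ifs <;> rfl

theorem splice_zero (X Y : Fin k → F) : splice 0 X Y = Y :=
  funext fun i => if_neg i.val.not_lt_zero

theorem splice_eq_left {s : ℕ} (hs : k ≤ s) (X Y : Fin k → F) : splice s X Y = X :=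
  funext fun i => if_pos (i.2.trans_le hs)

variable [Fintype F] [Nonempty F]

theorem expec_uniform_expec_uniform {α : Type*} [Fintype α] [Nonempty α] (ψ : α → α → ℝ≥0∞) :
    (expec (PMF.uniformOfFintype α) fun a => expec (PMF.uniformOfFintype α) (ψ a)) =
      (Fintype.card α : ℝ≥0∞)⁻¹ * ((Fintype.card α : ℝ≥0∞)⁻¹ * ∑ p : α × α, ψ p.1 p.2) := by
  simp only [expec_uniform, ← Finset.mul_sum, Fintype.sum_prod_type]

/-- Exchanging the coordinates from `s` on is a bijection of the pairs of points. -/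
theorem expec_uniform_splice (s : ℕ) (φ : (Fin k → F) → ℝ≥0∞) :
    (expec (PMF.uniformOfFintype _) fun W => expec (PMF.uniformOfFintype _) fun Y =>
      φ (splice s W Y)) = expec (PMF.uniformOfFintype (Fin k → F)) φ := by
  let exchange : ((Fin k → F) × (Fin k → F)) ≃ ((Fin k → F) × (Fin k → F)) :=
    Function.Involutive.toPerm (fun p => (splice s p.1 p.2, splice s p.2 p.1)) (by
      rintro ⟨W, Y⟩
      ext i <;> simp only [splice] <;> split_ifs <;> rfl)
  rw [expec_uniform_expec_uniform]
  change _ * (_ * ∑ p, φ (exchange p).1) = _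
  rw [exchange.sum_comp fun p => φ p.1, ← expec_uniform_expec_uniform fun W _ => φ W]
  simp only [expec_const]

theorem expec_uniform_splice_splice {s s' : ℕ} (h : s ≤ s') (X : Fin k → F)
    (φ : (Fin k → F) → ℝ≥0∞) :
    (expec (PMF.uniformOfFintype _) fun W => expec (PMF.uniformOfFintype _) fun Y =>
      φ (splice s' (splice s X W) Y)) =
      expec (PMF.uniformOfFintype (Fin k → F)) fun Y => φ (splice s X Y) := by
  simp only [← splice_splice_right h]
  exact expec_uniform_splice s' fun Y => φ (splice s X Y)

end

/-! ### Polynomial functions and the Schwartz–Zippel lemma -/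

section

variable {R : Type*} [CommRing R] {k D : ℕ}

/-- The functions given by polynomials of total degree at most `D`. -/
def IsPolyFun (D : ℕ) (φ : (Fin k → R) → R) : Prop :=
  ∃ p : MvPolynomial (Fin k) R, p.totalDegree ≤ D ∧ ∀ X, MvPolynomial.eval X p = φ X

namespace IsPolyFun

variable {φ ψ : (Fin k → R) → R}

theorem add (hφ : IsPolyFun D φ) (hψ : IsPolyFun D ψ) : IsPolyFun D fun X => φ X + ψ X := by
  obtain ⟨p, hp, eval_p⟩ := hφ
  obtain ⟨q, hq, eval_q⟩ := hψ
  exact ⟨p + q, (MvPolynomial.totalDegree_add p q).trans (max_le hp hq), by simp [eval_p, eval_q]⟩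

theorem const_mul (c : R) (hφ : IsPolyFun D φ) : IsPolyFun D fun X => c * φ X := by
  obtain ⟨p, hp, eval_p⟩ := hφ
  refine ⟨MvPolynomial.C c * p, (MvPolynomial.totalDegree_mul _ _).trans ?_, by simp [eval_p]⟩
  simpa using hp

theorem sub (hφ : IsPolyFun D φ) (hψ : IsPolyFun D ψ) : IsPolyFun D fun X => φ X - ψ X := by
  simpa only [neg_mul, one_mul, ← sub_eq_add_neg] using hφ.add (hψ.const_mul (-1))

theorem sum {ι : Type*} (s : Finset ι) {φ : ι → (Fin k → R) → R}
    (h : ∀ i ∈ s, IsPolyFun D (φ i)) : IsPolyFun D fun X => ∑ i ∈ s, φ i X := by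
  choose! p hp eval_p using h
  refine ⟨∑ i ∈ s, p i, MvPolynomial.totalDegree_finsetSum_le hp, fun X => ?_⟩
  rw [map_sum]
  exact Finset.sum_congr rfl fun i hi => eval_p i hi X

theorem subst (hφ : IsPolyFun D φ) {σ : (Fin k → R) → Fin k → R}
    (hσ : ∀ i, (∃ j, ∀ X, σ X i = X j) ∨ ∃ c, ∀ X, σ X i = c) : IsPolyFun D fun X => φ (σ X) := by
  obtain ⟨p, hp, eval_p⟩ := hφ
  have exists_coordinate (i : Fin k) : ∃ q : MvPolynomial (Fin k) R, q.totalDegree ≤ 1 ∧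
      ∀ X, MvPolynomial.eval X q = σ X i := by
    rcases hσ i with ⟨j, hj⟩ | ⟨c, hc⟩
    · exact ⟨MvPolynomial.X j,
        (MvPolynomial.totalDegree_monomial_le _ _).trans (by simp), by simp [hj]⟩
    · exact ⟨MvPolynomial.C c, by simp, by simp [hc]⟩
  choose q hq eval_q using exists_coordinate
  refine ⟨∑ e ∈ p.support, MvPolynomial.C (p.coeff e) * ∏ i, q i ^ e i, ?_, fun X => ?_⟩
  · refine MvPolynomial.totalDegree_finsetSum_le fun e he => ?_
    have he_le : ∑ i, e i ≤ D := by
      have := (MvPolynomial.le_totalDegree he).trans hp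
      rwa [Finsupp.sum_fintype _ _ fun _ => rfl] at this
    calc (MvPolynomial.C (p.coeff e) * ∏ i, q i ^ e i).totalDegree
        ≤ (∏ i, q i ^ e i).totalDegree := by
          simpa using MvPolynomial.totalDegree_mul (MvPolynomial.C (p.coeff e)) (∏ i, q i ^ e i)
      _ ≤ ∑ i, (q i ^ e i).totalDegree := MvPolynomial.totalDegree_finsetProd _ _
      _ ≤ ∑ i, e i := Finset.sum_le_sum fun i _ =>
          (MvPolynomial.totalDegree_pow _ _).trans (mul_le_of_le_one_right' (hq i))
      _ ≤ D := he_le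
  · simp only [← eval_p, map_sum, map_mul, map_prod, map_pow, MvPolynomial.eval_C, eval_q]
    rw [MvPolynomial.eval_eq']

theorem expec_eq_zero_le [IsDomain R] [Fintype R] [DecidableEq R] (hφ : IsPolyFun D φ)
    {Y : Fin k → R} (hY : φ Y ≠ 0) :
    (expec (PMF.uniformOfFintype (Fin k → R)) fun X => if φ X = 0 then 1 else 0) ≤
      (D : ℝ≥0∞) / Fintype.card R := by
  obtain ⟨p, hp, eval_p⟩ := hφ
  have p_ne_zero : p ≠ 0 := by
    rintro rfl
    exact hY (by simp [← eval_p])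
  have card_pos : (0 : ℚ≥0) < Fintype.card R := by exact_mod_cast Fintype.card_pos
  have schwartz_zippel := MvPolynomial.schwartz_zippel_totalDegree p_ne_zero Finset.univ
  rw [Fintype.piFinset_univ, Finset.card_univ, div_le_div_iff₀ (by positivity) card_pos]
    at schwartz_zippel
  have card_zeros : (Finset.univ.filter fun X => φ X = 0).card * Fintype.card R ≤
      D * Fintype.card R ^ k := by
    simp only [eval_p] at schwartz_zippel
    exact le_trans (mod_cast schwartz_zippel) (Nat.mul_le_mul_right _ hp)
  rw [expec_uniform, Finset.sum_boole, ENNReal.le_div_iff_mul_le (by simp) (by simp), mul_assoc,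
    mul_comm, ← div_eq_mul_inv, ENNReal.div_le_iff (by simp) (by simp), Fintype.card_fun,
    Fintype.card_fin]
  exact_mod_cast card_zeros

end IsPolyFun

theorem expec_mul_apply_eq_le {n : ℕ} {K : Type*} [Field K] [Fintype K] [DecidableEq K] (i : Fin n)
    {a : K} (ha : a ≠ 0) (b : K) :
    (expec (PMF.uniformOfFintype (Fin n → K)) fun u => if a * u i = b then 1 else 0) ≤
      1 / (Fintype.card K : ℝ≥0∞) := by
  have linear : IsPolyFun 1 fun u : Fin n → K => a * u i - b := by
    refine ⟨MvPolynomial.C a * MvPolynomial.X i - MvPolynomial.C b, ?_, by simp⟩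
    refine (MvPolynomial.totalDegree_sub_C_le _ _).trans ?_
    exact (MvPolynomial.totalDegree_mul _ _).trans (by simp)
  simpa [sub_eq_zero] using linear.expec_eq_zero_le (Y := fun _ => (b + 1) / a)
    (by simp [mul_div_cancel₀, ha])

end

/-! ### Sums over the coordinates that are not fixed yet -/

section

variable {F M : Type*} [Zero F] [AddCommMonoid M] {k : ℕ} (H : Finset F)

/-- The points of the cube over `H` in the coordinates of the interval `[s, s')`, `0` elsewhere. -/
def cube (k s s' : ℕ) : Finset (Fin k → F) :=
  Fintype.piFinset fun i : Fin k => if s ≤ i.val ∧ i.val < s' then H else {0}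

variable {H} in
theorem mem_cube {s s' : ℕ} {x : Fin k → F} : x ∈ cube H k s s' ↔
    ∀ i : Fin k, if s ≤ i.val ∧ i.val < s' then x i ∈ H else x i = 0 := by
  rw [cube, Fintype.mem_piFinset]
  refine forall_congr' fun i => ?_
  split_ifs <;> simp

/-- The sum over all values in `H` of the coordinates from `s` on, as a function of the others. -/
def tailSum (s : ℕ) (φ : (Fin k → F) → M) (X : Fin k → F) : M :=
  ∑ y ∈ cube H k s k, φ (splice s X y)

theorem sum_cube_tailSum {s s' : ℕ} (h : s ≤ s') (φ : (Fin k → F) → M) (X : Fin k → F) :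
    ∑ x ∈ cube H k s s', tailSum H s' φ (splice s X x) = tailSum H s φ X := by
  simp only [tailSum]
  rw [← Finset.sum_product']
  refine Finset.sum_nbij' (fun p => splice s' p.1 p.2)
    (fun y => (splice s' y 0, splice s' 0 y)) ?_ ?_ ?_ ?_ ?_
  · simp only [Finset.mem_product, mem_cube, splice]
    grind
  · simp only [Finset.mem_product, mem_cube, splice, Pi.zero_apply]
    grind
  · simp only [Finset.mem_product, mem_cube]
    rintro ⟨x, y⟩ hxy
    ext i <;> simp only [splice, Pi.zero_apply] <;> grind
  · intro y _
    rw [splice_splice_left]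
    ext i
    simp only [splice]
    split_ifs <;> rfl
  · rintro ⟨x, y⟩ -
    rw [splice_splice_right h]

theorem window_point {start len : ℕ} (hk : start + len ≤ k) (Y : Fin k → F) (i : Fin k) :
    (window k start len).point Y i =
      if h : i.val < len then Y ⟨start + i.val, by omega⟩ else 0 := by
  unfold Placement.point window
  by_cases h : i.val < len
  · have : start + i.val < k := by omega
    simp [h, this]
  · simp [h]

theorem window_point_congr {start len : ℕ} (hk : start + len ≤ k) {X Y : Fin k → F}
    (h : ∀ i : Fin k, start ≤ i.val → i.val < start + len → X i = Y i) :
    (window k start len).point X = (window k start len).point Y := by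
  funext i
  rw [window_point hk, window_point hk]
  split_ifs with hi
  · exact h _ (by simp) (by simpa using hi)
  · rfl

theorem sum_cube_window {start len : ℕ} (hk : start + len ≤ k) (φ : (Fin k → F) → M) :
    ∑ y ∈ cube H k start (start + len), φ ((window k start len).point y) =
      ∑ x ∈ cube H k 0 len, φ x := by
  refine Finset.sum_nbij' (fun y => (window k start len).point y)
    (fun x i => if h : start ≤ i.val ∧ i.val < start + len then x ⟨i.val - start, by omega⟩ else 0)
    ?_ ?_ ?_ ?_ fun _ _ => rfl
  · simp only [mem_cube, window_point hk]
    grind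
  · simp only [mem_cube]
    grind
  · simp only [mem_cube]
    intro y hy
    ext i
    simp only [window_point hk]
    grind
  · simp only [mem_cube]
    intro x hx
    ext i
    rw [window_point hk]
    grind

theorem sum_cube_one (hk : 0 < k) (φ : (Fin k → F) → M) :
    ∑ x ∈ cube H k 0 1, φ x = ∑ a ∈ H, φ fun i => if i.val = 0 then a else 0 := by
  refine Finset.sum_nbij' (fun x => x ⟨0, hk⟩) (fun a i => if i.val = 0 then a else 0)
    ?_ ?_ ?_ ?_ ?_
  · simp only [mem_cube]
    grind
  · simp only [mem_cube]
    grind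
  · simp only [mem_cube]
    intro x hx
    ext i
    grind
  · intro a _
    simp
  · simp only [mem_cube]
    intro x hx
    congr 1
    ext i
    grind

end

section

variable {F : Type*} [Field F] {k D : ℕ} {φ : (Fin k → F) → F}

theorem isPolyFun_eval {d : ℕ} (g : BPoly F k d D) :
    IsPolyFun D fun Y => MvPolynomial.eval Y g.1 :=
  ⟨g.1, g.2.2, fun _ => rfl⟩

theorem IsPolyFun.window (hφ : IsPolyFun D φ) {start len : ℕ} (hk : start + len ≤ k) :
    IsPolyFun D fun Y => φ ((window k start len).point Y) := by
  refine hφ.subst fun i => ?_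
  simp only [window_point hk]
  by_cases h : i.val < len
  · exact Or.inl ⟨⟨start + i.val, by omega⟩, by simp [h]⟩
  · exact Or.inr ⟨0, by simp [h]⟩

theorem IsPolyFun.splice (hφ : IsPolyFun D φ) (s : ℕ) (X : Fin k → F) :
    IsPolyFun D fun W => φ (splice s X W) := by
  refine hφ.subst fun i => ?_
  by_cases h : i.val < s
  · exact Or.inr ⟨X i, fun _ => if_pos h⟩
  · exact Or.inl ⟨i, fun _ => if_neg h⟩

theorem IsPolyFun.tailSum (hφ : IsPolyFun D φ) (H : Finset F) (s : ℕ) :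
    IsPolyFun D (tailSum H s φ) := by
  refine IsPolyFun.sum _ fun y _ => hφ.subst fun i => ?_
  by_cases h : i.val < s
  · exact Or.inl ⟨i, fun _ => if_pos h⟩
  · exact Or.inr ⟨y i, fun _ => if_neg h⟩

end

/-! ### The claims of Fold-DCS -/

/-- The first coordinate of the block of round `j`. -/
def foldStart (m j : ℕ) : ℕ := 2 ^ m - 2 ^ (m - j)

theorem foldStart_zero (m : ℕ) : foldStart m 0 = 0 := by simp [foldStart]

theorem foldStart_self (m : ℕ) : foldStart m m = 2 ^ m - 1 := by simp [foldStart]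

theorem foldStart_mono (m : ℕ) : Monotone (foldStart m) := fun _ _ h =>
  Nat.sub_le_sub_left (Nat.pow_le_pow_right two_pos (Nat.sub_le_sub_left h m)) _

theorem foldStart_le (m j : ℕ) : foldStart m j ≤ 2 ^ m := Nat.sub_le _ _

theorem foldStart_succ_add {m j : ℕ} (hj : j < m) :
    foldStart m (j + 1) + 2 ^ (m - 1 - j) = 2 ^ m := by
  rw [foldStart, Nat.add_comm j, ← Nat.sub_sub]
  exact Nat.sub_add_cancel (Nat.pow_le_pow_right two_pos (by omega))

theorem foldStart_add {m j : ℕ} (hj : j < m) :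
    foldStart m j + 2 ^ (m - 1 - j) = foldStart m (j + 1) := by
  have pow_eq : 2 ^ (m - j) = 2 * 2 ^ (m - 1 - j) := by
    rw [← pow_succ']
    congr 1
    omega
  have pow_le : 2 ^ (m - j) ≤ 2 ^ m := Nat.pow_le_pow_right two_pos (by omega)
  have add_eq := foldStart_succ_add hj
  rw [foldStart]
  omega

theorem tailWindow_eq {m j : ℕ} :
    tailWindow m j = window (2 ^ m) (foldStart m (j + 1)) (2 ^ (m - 1 - j)) := by
  rw [tailWindow, foldStart, Nat.add_comm j, ← Nat.sub_sub]

theorem blockWindow_eq (m j : ℕ) :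
    blockWindow m j = window (2 ^ m) (foldStart m j) (2 ^ (m - 1 - j)) := rfl

section

variable {F : Type*} [Zero F]

theorem blockWindow_point_splice_left {m j s : ℕ} (hj : j < m) (hs : foldStart m (j + 1) ≤ s)
    (X Y : Fin (2 ^ m) → F) :
    (blockWindow m j).point (splice s X Y) = (blockWindow m j).point X :=
  window_point_congr ((foldStart_add hj).trans_le (foldStart_le m (j + 1))) fun _ _ hi =>
    if_pos ((hi.trans_eq (foldStart_add hj)).trans_le hs)

theorem blockWindow_point_splice_right {m j : ℕ} (hj : j < m) (X Y : Fin (2 ^ m) → F) :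
    (blockWindow m j).point (splice (foldStart m j) X Y) = (blockWindow m j).point Y :=
  window_point_congr ((foldStart_add hj).trans_le (foldStart_le m (j + 1))) fun _ hi _ =>
    if_neg (not_lt.2 hi)

theorem tailWindow_point_splice {m j : ℕ} (hj : j < m) (X Y : Fin (2 ^ m) → F) :
    (tailWindow m j).point (splice (foldStart m (j + 1)) X Y) = (tailWindow m j).point Y := by
  rw [tailWindow_eq]
  exact window_point_congr (foldStart_succ_add hj).le fun _ hi _ => if_neg (not_lt.2 hi)

/-- The scalars, with value `0` outside their range. -/
def extendScalars {m : ℕ} (z : Fin m → F) (j : ℕ) : F := if h : j < m then z ⟨j, h⟩ else 0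

theorem extendScalars_of_lt {m j : ℕ} (z : Fin m → F) (h : j < m) :
    extendScalars z j = z ⟨j, h⟩ := dif_pos h

theorem extendScalars_splice_left {m l j : ℕ} (h : l < j) (z u : Fin m → F) :
    extendScalars (splice j z u) l = extendScalars z l := by
  unfold extendScalars
  split_ifs
  · exact if_pos h
  · rfl

theorem extendScalars_splice_right {m j : ℕ} (z u : Fin m → F) :
    extendScalars (splice j z u) j = extendScalars u j := by
  unfold extendScalars
  split_ifs
  · exact if_neg (lt_irrefl j)
  · rfl

end

section

variable {F : Type*} [Field F] {m d D : ℕ} (H : Finset F) (f : BPoly F (2 ^ m) d D) (S : F)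

/-- The folded polynomial before round `j`, as a function of all coordinates, if the polynomials
`G` are sent. -/
noncomputable def foldPoly (z : Fin m → F) (G : ℕ → BPoly F (2 ^ m) d D) (j : ℕ)
    (Y : Fin (2 ^ m) → F) : F :=
  MvPolynomial.eval Y f.1 + ∑ l ∈ Finset.range j,
    extendScalars z l * MvPolynomial.eval ((tailWindow m l).point Y) (G l).1

/-- The claimed sum of the folded polynomial before round `j`. -/
noncomputable def foldClaim (X : Fin (2 ^ m) → F) (z : Fin m → F)
    (G : ℕ → BPoly F (2 ^ m) d D) : ℕ → F
  | 0 => S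
  | j + 1 => extendScalars z j * foldClaim X z G j +
      MvPolynomial.eval ((blockWindow m j).point X) (G j).1

/-- The claim before round `j` is true. -/
def FoldTrue (X : Fin (2 ^ m) → F) (z : Fin m → F) (G : ℕ → BPoly F (2 ^ m) d D) (j : ℕ) : Prop :=
  tailSum H (foldStart m j) (foldPoly f z G j) X = foldClaim S X z G j

theorem foldPoly_congr {z z' : Fin m → F} {G G' : ℕ → BPoly F (2 ^ m) d D} {j : ℕ}
    (hz : ∀ l < j, extendScalars z l = extendScalars z' l) (hG : ∀ l < j, G l = G' l) :
    foldPoly f z G j = foldPoly f z' G' j := by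
  funext Y
  unfold foldPoly
  congr 1
  refine Finset.sum_congr rfl fun l hl => ?_
  rw [hz l (Finset.mem_range.1 hl), hG l (Finset.mem_range.1 hl)]

theorem foldClaim_congr {X X' : Fin (2 ^ m) → F} {z z' : Fin m → F}
    {G G' : ℕ → BPoly F (2 ^ m) d D} : ∀ {j : ℕ},
    (∀ l < j, (blockWindow m l).point X = (blockWindow m l).point X') →
    (∀ l < j, extendScalars z l = extendScalars z' l) → (∀ l < j, G l = G' l) →
    foldClaim S X z G j = foldClaim S X' z' G' j
  | 0, _, _, _ => rfl
  | j + 1, hX, hz, hG => by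
    rw [foldClaim, foldClaim, hX j j.lt_succ_self, hz j j.lt_succ_self, hG j j.lt_succ_self,
      foldClaim_congr (fun l hl => hX l (by omega)) (fun l hl => hz l (by omega))
        fun l hl => hG l (by omega)]

theorem foldClaim_splice {X W : Fin (2 ^ m) → F} {z : Fin m → F}
    {G : ℕ → BPoly F (2 ^ m) d D} {j : ℕ} (hj : j ≤ m) :
    foldClaim S (splice (foldStart m j) X W) z G j = foldClaim S X z G j :=
  foldClaim_congr S (fun _ hl => blockWindow_point_splice_left (hl.trans_le hj)
    (foldStart_mono m hl) X W) (fun _ _ => rfl) fun _ _ => rfl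

theorem foldTrue_congr {X : Fin (2 ^ m) → F} {z : Fin m → F}
    {G G' : ℕ → BPoly F (2 ^ m) d D} {j : ℕ} (hG : ∀ l < j, G l = G' l) :
    FoldTrue H f S X z G j ↔ FoldTrue H f S X z G' j := by
  unfold FoldTrue
  rw [foldPoly_congr f (fun _ _ => rfl) hG,
    foldClaim_congr S (fun _ _ => rfl) (fun _ _ => rfl) hG]

theorem isPolyFun_foldPoly (z : Fin m → F) (G : ℕ → BPoly F (2 ^ m) d D) {j : ℕ} (hj : j ≤ m) :
    IsPolyFun D (foldPoly f z G j) := by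
  refine (isPolyFun_eval f).add (IsPolyFun.sum _ fun l hl => IsPolyFun.const_mul _ ?_)
  rw [tailWindow_eq]
  exact (isPolyFun_eval (G l)).window
    (foldStart_succ_add ((Finset.mem_range.1 hl).trans_le hj)).le

/-- The sum over the cube of the polynomial sent in round `j`. -/
noncomputable def sentSum (g : BPoly F (2 ^ m) d D) (j : ℕ) : F :=
  ∑ x ∈ cube H (2 ^ m) 0 (2 ^ (m - 1 - j)), MvPolynomial.eval x g.1

theorem sum_cube_blockWindow (g : BPoly F (2 ^ m) d D) {j : ℕ} (hj : j < m) :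
    ∑ x ∈ cube H (2 ^ m) (foldStart m j) (foldStart m (j + 1)),
      MvPolynomial.eval ((blockWindow m j).point x) g.1 = sentSum H g j := by
  rw [← foldStart_add hj, blockWindow_eq]
  exact sum_cube_window H ((foldStart_add hj).trans_le (foldStart_le m (j + 1)))
    fun x => MvPolynomial.eval x g.1

theorem tailSum_tailWindow (g : BPoly F (2 ^ m) d D) {j : ℕ} (hj : j < m) (X : Fin (2 ^ m) → F) :
    tailSum H (foldStart m (j + 1)) (fun Y => MvPolynomial.eval ((tailWindow m j).point Y) g.1) X =
      sentSum H g j := by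
  have sum_window := sum_cube_window H (foldStart_succ_add hj).le fun x => MvPolynomial.eval x g.1
  rw [foldStart_succ_add hj, ← tailWindow_eq] at sum_window
  simpa only [tailSum, sentSum, tailWindow_point_splice hj] using sum_window

theorem foldTrue_succ_iff {X W : Fin (2 ^ m) → F} {z u : Fin m → F}
    {G : ℕ → BPoly F (2 ^ m) d D} {j : ℕ} (hj : j < m) :
    FoldTrue H f S (splice (foldStart m j) X W) (splice j z u) G (j + 1) ↔
      tailSum H (foldStart m (j + 1)) (foldPoly f z G j) (splice (foldStart m j) X W) +
          u ⟨j, hj⟩ * sentSum H (G j) j =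
        u ⟨j, hj⟩ * foldClaim S X z G j +
          MvPolynomial.eval ((blockWindow m j).point W) (G j).1 := by
  have scalars_eq (l : ℕ) (hl : l < j) :
      extendScalars (splice j z u) l = extendScalars z l := extendScalars_splice_left hl z u
  have foldPoly_succ : foldPoly f (splice j z u) G (j + 1) = fun Y => foldPoly f z G j Y +
      u ⟨j, hj⟩ * MvPolynomial.eval ((tailWindow m j).point Y) (G j).1 := by
    funext Y
    rw [← foldPoly_congr f scalars_eq fun l _ => rfl, foldPoly, foldPoly, Finset.sum_range_succ,
      extendScalars_splice_right, extendScalars_of_lt u hj, add_assoc]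
  have tailSum_succ : tailSum H (foldStart m (j + 1)) (foldPoly f (splice j z u) G (j + 1))
      (splice (foldStart m j) X W) =
      tailSum H (foldStart m (j + 1)) (foldPoly f z G j) (splice (foldStart m j) X W) +
          u ⟨j, hj⟩ * sentSum H (G j) j := by
    rw [foldPoly_succ, ← tailSum_tailWindow H (G j) hj (splice (foldStart m j) X W)]
    simp only [tailSum, Finset.sum_add_distrib, Finset.mul_sum]
  rw [FoldTrue, tailSum_succ, foldClaim, extendScalars_splice_right, extendScalars_of_lt u hj,
    blockWindow_point_splice_right hj, foldClaim_splice S hj.le,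
    foldClaim_congr S (fun _ _ => rfl) scalars_eq fun _ _ => rfl]

variable [Fintype F] {X : Fin (2 ^ m) → F} {z : Fin m → F} {G : ℕ → BPoly F (2 ^ m) d D} {j : ℕ}

open Classical in
/-- If the polynomial sent has the claimed sum, the difference of the two sides of the new claim
does not depend on the new scalar, and its sum over the block of round `j` is the error of the old
claim. -/
theorem expec_foldTrue_succ_le_of_eq (hj : j < m) (hfalse : ¬ FoldTrue H f S X z G j)
    (hsum : foldClaim S X z G j = sentSum H (G j) j) (u : Fin m → F) :
    (expec (PMF.uniformOfFintype (Fin (2 ^ m) → F)) fun W =>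
      if FoldTrue H f S (splice (foldStart m j) X W) (splice j z u) G (j + 1) then 1 else 0) ≤
      (D : ℝ≥0∞) / Fintype.card F := by
  have error_poly : IsPolyFun D fun W =>
      tailSum H (foldStart m (j + 1)) (foldPoly f z G j) (splice (foldStart m j) X W) -
        MvPolynomial.eval ((blockWindow m j).point W) (G j).1 :=
    (((isPolyFun_foldPoly f z G hj.le).tailSum H _).splice _ _).sub ((isPolyFun_eval (G j)).window
      ((foldStart_add hj).trans_le (foldStart_le m (j + 1))))
  have error_sum : ∑ x ∈ cube H (2 ^ m) (foldStart m j) (foldStart m (j + 1)),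
      (tailSum H (foldStart m (j + 1)) (foldPoly f z G j) (splice (foldStart m j) X x) -
        MvPolynomial.eval ((blockWindow m j).point x) (G j).1) ≠ 0 := by
    rw [Finset.sum_sub_distrib, sum_cube_blockWindow H (G j) hj,
      sum_cube_tailSum H (foldStart_mono m (Nat.le_succ j)), sub_ne_zero, ← hsum]
    exact hfalse
  obtain ⟨Y, -, hY⟩ := Finset.exists_ne_zero_of_sum_ne_zero error_sum
  refine le_trans (expec_mono fun W => ?_) (error_poly.expec_eq_zero_le hY)
  rw [foldTrue_succ_iff H f S hj, hsum, sub_eq_zero, add_comm, add_right_inj]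

open Classical in
/-- Otherwise the new claim is a nontrivial linear equation for the new scalar. -/
theorem expec_foldTrue_succ_le_of_ne (hj : j < m)
    (hsum : foldClaim S X z G j ≠ sentSum H (G j) j) (W : Fin (2 ^ m) → F) :
    (expec (PMF.uniformOfFintype (Fin m → F)) fun u =>
      if FoldTrue H f S (splice (foldStart m j) X W) (splice j z u) G (j + 1) then 1 else 0) ≤
      1 / (Fintype.card F : ℝ≥0∞) := by
  refine le_trans (expec_mono fun u => ?_) (expec_mul_apply_eq_le ⟨j, hj⟩
    (sub_ne_zero.2 hsum.symm) (MvPolynomial.eval ((blockWindow m j).point W) (G j).1 -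
      tailSum H (foldStart m (j + 1)) (foldPoly f z G j) (splice (foldStart m j) X W)))
  refine le_of_eq (if_congr ((foldTrue_succ_iff H f S hj).trans ?_) rfl rfl)
  constructor <;> intro h <;> linear_combination h

open Classical in
theorem expec_foldTrue_succ_le (hj : j < m) (hfalse : ¬ FoldTrue H f S X z G j) :
    (expec (PMF.uniformOfFintype (Fin (2 ^ m) → F)) fun W =>
      expec (PMF.uniformOfFintype (Fin m → F)) fun u =>
        if FoldTrue H f S (splice (foldStart m j) X W) (splice j z u) G (j + 1) then 1 else 0) ≤
      max ((D : ℝ≥0∞) / Fintype.card F) (1 / Fintype.card F) := by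
  by_cases hsum : foldClaim S X z G j = sentSum H (G j) j
  · rw [expec_comm]
    exact le_max_of_le_left (expec_le fun u =>
      expec_foldTrue_succ_le_of_eq H f S hj hfalse hsum u)
  · exact le_max_of_le_right (expec_le fun W => expec_foldTrue_succ_le_of_ne H f S hj hsum W)

end

/-! ### Soundness of Fold-DCS against provers who send true values -/

section

variable {F : Type*} [Field F] {m d D : ℕ}

theorem foldClaim_eq (S : F) (X : Fin (2 ^ m) → F) (z : Fin m → F)
    (G : ℕ → BPoly F (2 ^ m) d D) : ∀ j, foldClaim S X z G j =
      (∏ l ∈ Finset.range j, extendScalars z l) * S + ∑ i ∈ Finset.range j,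
        (∏ l ∈ Finset.Ico (i + 1) j, extendScalars z l) *
          MvPolynomial.eval ((blockWindow m i).point X) (G i).1
  | 0 => by simp [foldClaim]
  | j + 1 => by
    rw [foldClaim, foldClaim_eq S X z G j, Finset.prod_range_succ, Finset.sum_range_succ,
      Finset.Ico_self, Finset.prod_empty, one_mul, mul_add, Finset.mul_sum, ← add_assoc]
    congr 2
    · ring
    · refine Finset.sum_congr rfl fun i hi => ?_
      rw [Finset.prod_Ico_succ_top (Finset.mem_range.1 hi)]
      ring

theorem eval_toUnivariate {k : ℕ} (g : BPoly F k d D) (a : F) :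
    (toUnivariate g).eval a = MvPolynomial.eval (fun i => if i.val = 0 then a else 0) g.1 := by
  rw [toUnivariate, ← Polynomial.coe_aeval_eq_eval, MvPolynomial.comp_aeval_apply,
    MvPolynomial.aeval_eq_eval]
  simp only [apply_ite (Polynomial.aeval a), Polynomial.aeval_X, map_zero]

theorem natDegree_toUnivariate_le {k : ℕ} (hk : 0 < k) (g : BPoly F k d D) :
    (toUnivariate g).natDegree ≤ d := by
  rw [toUnivariate, MvPolynomial.aeval_def, MvPolynomial.eval₂_eq']
  refine Polynomial.natDegree_sum_le_of_forall_le _ _ fun e he => ?_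
  calc (algebraMap F (Polynomial F) (g.1.coeff e) *
        ∏ i : Fin k, (if i.val = 0 then Polynomial.X else 0) ^ e i).natDegree
      ≤ ∑ i : Fin k, ((if i.val = 0 then Polynomial.X else 0 : Polynomial F) ^ e i).natDegree :=
        (Polynomial.natDegree_C_mul_le _ _).trans (Polynomial.natDegree_prod_le _ _)
    _ ≤ ∑ i : Fin k, if i = ⟨0, hk⟩ then e i else 0 := by
        refine Finset.sum_le_sum fun i _ => Polynomial.natDegree_pow_le.trans ?_
        by_cases hi : i.val = 0 <;> simp [hi, Fin.ext_iff]
    _ = e ⟨0, hk⟩ := by simp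
    _ ≤ d := (MvPolynomial.monomial_le_degreeOf ⟨0, hk⟩ he).trans (g.2.1 ⟨0, hk⟩)

/-- The index of the polynomial of which the value of index `i` is claimed. -/
def foldIndex (m : ℕ) (i : Fin (2 * m + 1)) : ℕ :=
  if i.val < m then i.val else if i.val < 2 * m then i.val - m else m

theorem foldIndex_le (i : Fin (2 * m + 1)) : foldIndex m i ≤ m := by
  unfold foldIndex
  split_ifs <;> omega

theorem foldCommitments_eq (C : ℕ → Dat) (i : Fin (2 * m + 1)) :
    foldCommitments m C i = C (foldIndex m i) := by
  unfold foldCommitments foldIndex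
  split_ifs <;> rfl

/-- The true values for the evaluations of Fold-DCS, if the polynomials `G` are sent. -/
noncomputable def foldValues (X : Fin (2 ^ m) → F) (G : ℕ → BPoly F (2 ^ m) d D) :
    Fin (2 * m + 1) → F :=
  PCS.values (foldPlacement m) X fun i => G (foldIndex m i)

section

variable (X : Fin (2 ^ m) → F) (G : ℕ → BPoly F (2 ^ m) d D)

theorem foldValues_block (j : Fin m) : foldValues X G ⟨j.val, by omega⟩ =
    MvPolynomial.eval ((blockWindow m j).point X) (G j).1 := by
  simp [foldValues, PCS.values, foldPlacement, foldIndex]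

theorem foldValues_tail (j : Fin m) : foldValues X G ⟨m + j.val, by omega⟩ =
    MvPolynomial.eval ((tailWindow m j).point X) (G j).1 := by
  have lt_two_mul : m + j.val < 2 * m := by omega
  simp [foldValues, PCS.values, foldPlacement, foldIndex, lt_two_mul]

theorem foldValues_last : foldValues X G ⟨2 * m, by omega⟩ =
    MvPolynomial.eval ((window (2 ^ m) (2 ^ m - 1) 1).point X) (G m).1 := by
  have not_lt : ¬ 2 * m < m := by omega
  simp [foldValues, PCS.values, foldPlacement, foldIndex, not_lt]

theorem prod_filter_lt_eq (z : Fin m → F) (j : Fin m) :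
    ∏ l ∈ Finset.univ.filter (fun l => j < l), z l =
      ∏ l ∈ Finset.Ico (j.val + 1) m, extendScalars z l := by
  refine Finset.prod_bij (fun l _ => l.val) (fun l hl => ?_) (fun _ _ _ _ => Fin.ext)
    (fun l hl => ?_) fun l _ => (extendScalars_of_lt z l.2).symm
  · exact Finset.mem_Ico.2 ⟨(Finset.mem_filter.1 hl).2, l.2⟩
  · obtain ⟨lt_l, l_lt⟩ := Finset.mem_Ico.1 hl
    exact ⟨⟨l, l_lt⟩, Finset.mem_filter.2 ⟨Finset.mem_univ _, lt_l⟩, rfl⟩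

theorem foldSum_foldValues (S : F) (z : Fin m → F) :
    foldSum m z S (foldValues X G) = foldClaim S X z G m := by
  simp only [foldClaim_eq, foldSum, Finset.prod_range, Finset.sum_range, foldValues_block,
    prod_filter_lt_eq, extendScalars_of_lt z (Fin.is_lt _), Fin.eta]

theorem foldConsistent_foldValues (f : BPoly F (2 ^ m) d D) (z : Fin m → F) :
    foldConsistent m z (MvPolynomial.eval X f.1) (foldValues X G) ↔
      MvPolynomial.eval ((window (2 ^ m) (2 ^ m - 1) 1).point X) (G m).1 = foldPoly f z G m X := by
  simp only [foldConsistent, foldPoly, Finset.sum_range, foldValues_last, foldValues_tail,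
    extendScalars_of_lt z (Fin.is_lt _), Fin.eta]

end

variable (H : Finset F) (f : BPoly F (2 ^ m) d D) (S : F) (p : ℝ≥0∞)

open Classical in
/-- The probability of acceptance at the end of the protocol, if the prover sends the true values of
the polynomials `G` he is committed to, where `p` is the soundness error of the univariate
sumcheck. -/
noncomputable def foldPayoff (X : Fin (2 ^ m) → F) (z : Fin m → F)
    (G : ℕ → BPoly F (2 ^ m) d D) : ℝ≥0∞ :=
  if foldConsistent m z (MvPolynomial.eval X f.1) (foldValues X G) then
    if ∑ a ∈ H, (toUnivariate (G m)).eval a = foldSum m z S (foldValues X G) then 1 else p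
  else 0

theorem foldPayoff_le_one (hp : p ≤ 1) (X : Fin (2 ^ m) → F) (z : Fin m → F)
    (G : ℕ → BPoly F (2 ^ m) d D) : foldPayoff H f S p X z G ≤ 1 := by
  unfold foldPayoff
  split_ifs <;> simp [hp]

theorem foldPayoff_congr (X : Fin (2 ^ m) → F) (z : Fin m → F) {G G' : ℕ → BPoly F (2 ^ m) d D}
    (hG : ∀ l ≤ m, G l = G' l) : foldPayoff H f S p X z G = foldPayoff H f S p X z G' := by
  have values_eq : foldValues X G = foldValues X G' := by
    simp only [foldValues, hG _ (foldIndex_le _)]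
  rw [foldPayoff, foldPayoff, values_eq, hG m le_rfl]

theorem sum_eval_toUnivariate (g : BPoly F (2 ^ m) d D) :
    ∑ a ∈ H, (toUnivariate g).eval a = ∑ W ∈ cube H (2 ^ m) (foldStart m m) (2 ^ m),
      MvPolynomial.eval ((window (2 ^ m) (2 ^ m - 1) 1).point W) g.1 := by
  have sum_window := sum_cube_window H (Nat.sub_add_cancel (Nat.one_le_two_pow (n := m))).le
    fun x => MvPolynomial.eval x g.1
  rw [Nat.sub_add_cancel Nat.one_le_two_pow, sum_cube_one H (Nat.two_pow_pos m)] at sum_window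
  simp only [eval_toUnivariate, foldStart_self, sum_window]

variable [Fintype F]

/-- The polynomials on the two sides of the consistency check differ, since their sums over the last
coordinate do. -/
theorem expec_last_check_le [DecidableEq F] {X : Fin (2 ^ m) → F} {z : Fin m → F}
    {G : ℕ → BPoly F (2 ^ m) d D} (hfalse : ¬ FoldTrue H f S X z G m)
    (hsum : ∑ a ∈ H, (toUnivariate (G m)).eval a = foldClaim S X z G m) :
    (expec (PMF.uniformOfFintype (Fin (2 ^ m) → F)) fun W =>
      if MvPolynomial.eval ((window (2 ^ m) (2 ^ m - 1) 1).point W) (G m).1 =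
        foldPoly f z G m (splice (foldStart m m) X W) then 1 else 0) ≤
      (D : ℝ≥0∞) / Fintype.card F := by
  have error_poly : IsPolyFun D fun W =>
      MvPolynomial.eval ((window (2 ^ m) (2 ^ m - 1) 1).point W) (G m).1 -
        foldPoly f z G m (splice (foldStart m m) X W) :=
    ((isPolyFun_eval (G m)).window (Nat.sub_add_cancel Nat.one_le_two_pow).le).sub
      ((isPolyFun_foldPoly f z G le_rfl).splice _ _)
  have error_sum : ∑ W ∈ cube H (2 ^ m) (foldStart m m) (2 ^ m),
      (MvPolynomial.eval ((window (2 ^ m) (2 ^ m - 1) 1).point W) (G m).1 -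
        foldPoly f z G m (splice (foldStart m m) X W)) ≠ 0 := by
    rw [Finset.sum_sub_distrib, ← sum_eval_toUnivariate, hsum, sub_ne_zero]
    exact Ne.symm hfalse
  obtain ⟨Y, -, hY⟩ := Finset.exists_ne_zero_of_sum_ne_zero error_sum
  simpa only [sub_eq_zero] using error_poly.expec_eq_zero_le hY

theorem expec_foldPayoff_le {X : Fin (2 ^ m) → F} {z : Fin m → F}
    {G : ℕ → BPoly F (2 ^ m) d D} (hfalse : ¬ FoldTrue H f S X z G m) :
    (expec (PMF.uniformOfFintype (Fin (2 ^ m) → F)) fun W =>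
      foldPayoff H f S p (splice (foldStart m m) X W) z G) ≤
      max p ((D : ℝ≥0∞) / Fintype.card F) := by
  classical
  have last_eq (W : Fin (2 ^ m) → F) :
      (window (2 ^ m) (2 ^ m - 1) 1).point (splice (foldStart m m) X W) =
        (window (2 ^ m) (2 ^ m - 1) 1).point W :=
    window_point_congr (Nat.sub_add_cancel Nat.one_le_two_pow).le fun i hi _ =>
      if_neg (not_lt.2 ((foldStart_self m).trans_le hi))
  simp only [foldPayoff, foldSum_foldValues, foldConsistent_foldValues, foldClaim_splice S le_rfl,
    last_eq]
  by_cases hsum : ∑ a ∈ H, (toUnivariate (G m)).eval a = foldClaim S X z G m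
  · simp only [if_pos hsum]
    exact le_max_of_le_right (expec_last_check_le H f S hfalse hsum)
  · refine le_max_of_le_left (expec_le fun W => ?_)
    rw [if_neg hsum]
    split_ifs <;> simp

end

section

variable {F : Type*} [Field F] {m d D : ℕ}

/-- The polynomials behind the replies of a prover, where `Γ` chooses a polynomial for each
commitment. -/
def polysOf (Γ : Dat → BPoly F (2 ^ m) d D) (h : List Dat) (j : ℕ) : BPoly F (2 ^ m) d D :=
  Γ (h.getD j Dat.nil)

theorem polysOf_append (Γ : Dat → BPoly F (2 ^ m) d D) (h l : List Dat) {j : ℕ}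
    (hj : j < h.length) : polysOf Γ (h ++ l) j = polysOf Γ h j := by
  rw [polysOf, polysOf, List.getD_append _ _ _ _ hj]

theorem foldTrue_polysOf_append (H : Finset F) (f : BPoly F (2 ^ m) d D) (S : F)
    (Γ : Dat → BPoly F (2 ^ m) d D) {X : Fin (2 ^ m) → F} {z : Fin m → F} {h : List Dat}
    (a : Dat) : FoldTrue H f S X z (polysOf Γ (h ++ [a])) h.length ↔
      FoldTrue H f S X z (polysOf Γ h) h.length :=
  foldTrue_congr H f S fun _ hl => polysOf_append Γ h [a] hl

variable [Fintype F]

theorem foldMsg_splice {j : ℕ} (hj : j ≤ m) (X Y : Fin (2 ^ m) → F) (z v : Fin m → F) :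
    foldMsg m (splice (foldStart m j) X Y) (splice j z v) j = foldMsg m X z j := by
  rcases j with _ | j
  · rfl
  · have scalar_eq : splice (j + 1) z v ⟨j, hj⟩ = z ⟨j, hj⟩ := if_pos j.lt_succ_self
    simp [foldMsg, Nat.lt_of_succ_le hj, blockWindow_point_splice_left hj le_rfl, scalar_eq]

variable (H : Finset F) (f : BPoly F (2 ^ m) d D) (S : F) (p : ℝ≥0∞)
  (Γ : Dat → BPoly F (2 ^ m) d D) (step : Dat → PMF Dat)

/-- The expected payoff of a prover who has given the replies `h` and is in the state `st`, with `k`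
replies to come, if the coins of the verifier are `X` and `z`. -/
noncomputable def expectedPayoff (k : ℕ) (st : Dat) (h : List Dat) (X : Fin (2 ^ m) → F)
    (z : Fin m → F) : ℝ≥0∞ :=
  expec (talk step (fun h => foldMsg m X z h.length) k st h) fun r =>
    foldPayoff H f S p X z (polysOf Γ r.2)

theorem expectedPayoff_le_one (hp : p ≤ 1) (k : ℕ) (st : Dat) (h : List Dat)
    (X : Fin (2 ^ m) → F) (z : Fin m → F) : expectedPayoff H f S p Γ step k st h X z ≤ 1 :=
  expec_le fun r => foldPayoff_le_one H f S p hp X z (polysOf Γ r.2)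

theorem expectedPayoff_eq_of_lt_length (k : ℕ) (st : Dat) {h : List Dat} (hlen : m < h.length)
    (X : Fin (2 ^ m) → F) (z : Fin m → F) :
    expectedPayoff H f S p Γ step k st h X z = foldPayoff H f S p X z (polysOf Γ h) := by
  rw [expectedPayoff, ← expec_const (talk step _ k st h) (foldPayoff H f S p X z (polysOf Γ h))]
  refine expec_congr_of_support fun r hr => foldPayoff_congr H f S p X z fun l hl => ?_
  obtain ⟨l', -, hr⟩ := exists_replies_of_mem_support_talk hr
  rw [hr, polysOf_append Γ h l' (hl.trans_lt hlen)]

/-- The expected payoff, if the replies `h` have been given and the coins that the verifier has not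
used yet are drawn anew. -/
noncomputable def futurePayoff (k : ℕ) (st : Dat) (h : List Dat) (X : Fin (2 ^ m) → F)
    (z : Fin m → F) : ℝ≥0∞ :=
  expec (PMF.uniformOfFintype (Fin (2 ^ m) → F)) fun Y =>
    expec (PMF.uniformOfFintype (Fin m → F)) fun v => expectedPayoff H f S p Γ step k st h
      (splice (foldStart m h.length) X Y) (splice h.length z v)

theorem futurePayoff_succ_le {k : ℕ} {st : Dat} {h : List Dat} (hlen : h.length ≤ m)
    {X : Fin (2 ^ m) → F} {z : Fin m → F} {c : ℝ≥0∞}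
    (hc : ∀ st' a : Dat, (expec (PMF.uniformOfFintype (Fin (2 ^ m) → F)) fun Y =>
      expec (PMF.uniformOfFintype (Fin m → F)) fun v => expectedPayoff H f S p Γ step k st'
        (h ++ [a]) (splice (foldStart m h.length) X Y) (splice h.length z v)) ≤ c) :
    futurePayoff H f S p Γ step (k + 1) st h X z ≤ c := by
  simp only [futurePayoff, expectedPayoff, talk, expec_bind, foldMsg_splice hlen]
  simp only [expec_comm (PMF.uniformOfFintype (Fin m → F)) (step _)]
  rw [expec_comm]
  exact expec_le fun o => hc o.hd o.tl

/-- The coins of the current round are drawn first, and then those of the later ones. -/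
theorem expec_futurePayoff (k : ℕ) (st a : Dat) (h : List Dat) (X : Fin (2 ^ m) → F)
    (z : Fin m → F) :
    (expec (PMF.uniformOfFintype (Fin (2 ^ m) → F)) fun W =>
      expec (PMF.uniformOfFintype (Fin m → F)) fun u => futurePayoff H f S p Γ step k st (h ++ [a])
        (splice (foldStart m h.length) X W) (splice h.length z u)) =
      expec (PMF.uniformOfFintype (Fin (2 ^ m) → F)) fun Y =>
        expec (PMF.uniformOfFintype (Fin m → F)) fun v => expectedPayoff H f S p Γ step k st
          (h ++ [a]) (splice (foldStart m h.length) X Y) (splice h.length z v) := by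
  simp only [futurePayoff, List.length_append, List.length_singleton]
  simp only [expec_comm (PMF.uniformOfFintype (Fin m → F))
    (PMF.uniformOfFintype (Fin (2 ^ m) → F))]
  simp only [expec_uniform_splice_splice (foldStart_mono m (Nat.le_succ h.length)) X fun X' =>
    expec (PMF.uniformOfFintype (Fin m → F)) fun u => expec (PMF.uniformOfFintype (Fin m → F))
      fun v => expectedPayoff H f S p Γ step k st (h ++ [a]) X'
        (splice (h.length + 1) (splice h.length z u) v)]
  simp only [expec_uniform_splice_splice (Nat.le_succ h.length) z]

variable {X : Fin (2 ^ m) → F} {z : Fin m → F} {h : List Dat}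

theorem futurePayoff_two_le (st : Dat) (hlen : h.length = m)
    (hfalse : ¬ FoldTrue H f S X z (polysOf Γ h) h.length) :
    futurePayoff H f S p Γ step 2 st h X z ≤ max p ((D : ℝ≥0∞) / Fintype.card F) := by
  refine futurePayoff_succ_le H f S p Γ step hlen.le fun st' a => ?_
  rw [← foldTrue_polysOf_append H f S Γ a, hlen] at hfalse
  refine le_trans (expec_mono fun Y => expec_le fun v => le_of_eq ?_)
    (expec_foldPayoff_le H f S p hfalse)
  rw [expectedPayoff_eq_of_lt_length H f S p Γ step _ _ (by simp [hlen]), hlen,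
    splice_eq_left le_rfl]

theorem futurePayoff_succ_le_of_forall (hp : p ≤ 1) {k : ℕ} {b : ℝ≥0∞} (st : Dat)
    (hlen : h.length < m) (hfalse : ¬ FoldTrue H f S X z (polysOf Γ h) h.length)
    (hb : ∀ (st' : Dat) (h' : List Dat) (X' : Fin (2 ^ m) → F) (z' : Fin m → F),
      h'.length = h.length + 1 → ¬ FoldTrue H f S X' z' (polysOf Γ h') h'.length →
        futurePayoff H f S p Γ step k st' h' X' z' ≤ b) :
    futurePayoff H f S p Γ step (k + 1) st h X z ≤
      max ((D : ℝ≥0∞) / Fintype.card F) (1 / Fintype.card F) * (1 - b) + b := by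
  classical
  refine futurePayoff_succ_le H f S p Γ step hlen.le fun st' a => ?_
  rw [← expec_futurePayoff]
  rw [← foldTrue_polysOf_append H f S Γ a] at hfalse
  calc _ ≤ expec (PMF.uniformOfFintype (Fin (2 ^ m) → F)) fun W =>
        expec (PMF.uniformOfFintype (Fin m → F)) fun u =>
          (if FoldTrue H f S (splice (foldStart m h.length) X W) (splice h.length z u)
            (polysOf Γ (h ++ [a])) (h.length + 1) then 1 else 0) * (1 - b) + b := by
        refine expec_mono fun W => expec_mono fun u => ?_
        split_ifs with htrue
        · rw [one_mul]
          exact (expec_le fun Y => expec_le fun v => expectedPayoff_le_one H f S p Γ step hp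
            _ _ _ _ _).trans le_tsub_add
        · rw [zero_mul, zero_add]
          exact hb st' (h ++ [a]) _ _ (by simp) (by simpa using htrue)
    _ ≤ _ := by
        simp only [expec_add, expec_const, expec_mul_const]
        gcongr
        exact expec_foldTrue_succ_le H f S hlen hfalse

theorem futurePayoff_le (hp : p ≤ 1) {b : ℕ → ℝ≥0∞}
    (hb₀ : max p ((D : ℝ≥0∞) / Fintype.card F) ≤ b 0)
    (hb : ∀ n, max ((D : ℝ≥0∞) / Fintype.card F) (1 / Fintype.card F) * (1 - b n) + b n ≤
      b (n + 1)) {n : ℕ} (st : Dat) (hlen : h.length + n = m)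
    (hfalse : ¬ FoldTrue H f S X z (polysOf Γ h) h.length) :
    futurePayoff H f S p Γ step (n + 2) st h X z ≤ b n := by
  induction n generalizing st h X z with
  | zero => exact (futurePayoff_two_le H f S p Γ step st hlen hfalse).trans hb₀
  | succ n ih =>
    exact (futurePayoff_succ_le_of_forall H f S p Γ step hp st (by omega) hfalse
      fun st' h' X' z' hlen' => ih st' (by omega)).trans (hb n)

end

/-! ### Soundness of Fold-DCS -/

section

variable {F : Type*} [Field F] [Fintype F] {m d D : ℕ} (pcs : PCS F (2 ^ m) d D)
  (US : USVerifier F) (P : PPT) (f : BPoly F (2 ^ m) d D) (S : F)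

/-- The conversation in the commitment phase of Fold-DCS and the reply to `β`, for the coins `X` and
`z` of the verifier. -/
noncomputable def foldTalk (X : Fin (2 ^ m) → F) (z : Fin m → F) (sec : ℕ) (pp : Dat) :
    PMF (Dat × List Dat) :=
  talk (P.run sec) (fun h => foldMsg m X z h.length) (m + 2)
    (startState (Dat.cons pp (Dat.cons (codePoly f) (code S)))) []

open Classical in
/-- The last two checks of the verifier and the decision, for the alleged values `y` and the oracle
polynomial `g`, after a conversation with final state `st` and replies `C`. -/
noncomputable def foldDecision (X : Fin (2 ^ m) → F) (z : Fin m → F) (sec : ℕ) (pp st : Dat)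
    (C : ℕ → Dat) (y : Fin (2 * m + 1) → F) (g : BPoly F (2 ^ m) d D) : PMF Bool :=
  ((pcs.evalV (foldPlacement m) sec pp (foldCommitments m C) X y).interact (P.run sec) st).bind
    fun e => ((US (toUnivariate g) (foldSum m z S y)).interact (P.run sec) e.2).map fun u =>
      decide ((∀ j < m, pcs.IsCommitment pp (C j)) ∧ pcs.opens pp g (C m) = true ∧
        foldConsistent m z (MvPolynomial.eval X f.1) y ∧ e.1 = true ∧ u.1 = true)

/-- The decision of the verifier after the conversation `r`. -/
noncomputable def foldVerdict (X : Fin (2 ^ m) → F) (z : Fin m → F) (sec : ℕ) (pp : Dat)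
    (r : Dat × List Dat) : PMF Bool :=
  match decodeVec F (2 * m + 1) (r.2.getD (m + 1) Dat.nil).hd,
      decodePoly F (2 ^ m) d D (r.2.getD (m + 1) Dat.nil).tl with
  | some y, some g =>
      foldDecision pcs US P f S X z sec pp r.1 (fun j => r.2.getD j Dat.nil) y g
  | _, _ => PMF.pure false

theorem foldDCS_eq (sec : ℕ) : foldDCS pcs US P sec f S =
    (pcs.setup sec).bind fun pp => (PMF.uniformOfFintype (Fin (2 ^ m) → F)).bind fun X =>
      (PMF.uniformOfFintype (Fin m → F)).bind fun z =>
        (foldTalk P f S X z sec pp).bind (foldVerdict pcs US P f S X z sec pp) := rfl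

variable {pcs US f S} (X : Fin (2 ^ m) → F) (z : Fin m → F) (sec : ℕ) (pp st : Dat)
  {C : ℕ → Dat} {y : Fin (2 * m + 1) → F} {g : BPoly F (2 ^ m) d D}

theorem foldDecision_true_eq_zero
    (h : ¬ ((∀ j < m, pcs.IsCommitment pp (C j)) ∧ pcs.opens pp g (C m) = true ∧
      foldConsistent m z (MvPolynomial.eval X f.1) y)) :
    foldDecision pcs US P f S X z sec pp st C y g true = 0 := by
  rw [foldDecision, bind_apply_true]
  refine le_antisymm (expec_le fun e => ?_) zero_le
  rw [map_decide_apply_true]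
  refine expec_le fun u => ?_
  rw [if_neg fun ⟨commits, opens, consistent, _⟩ => h ⟨commits, opens, consistent⟩]

theorem foldDecision_true_le_convinceProb :
    foldDecision pcs US P f S X z sec pp st C y g true ≤
      pcs.convinceProb (foldPlacement m) P sec pp st (foldCommitments m C) X y := by
  rw [PCS.convinceProb, foldDecision, bind_apply_true, apply_true_eq_expec, expec_map]
  refine expec_mono fun e => ?_
  rw [map_decide_apply_true]
  refine expec_le fun u => ?_
  split_ifs with accepts convinced
  · exact le_rfl
  · exact absurd accepts.2.2.2.1 convinced
  · exact zero_le
  · exact le_rfl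

theorem foldDecision_true_le_ofReal {H : Finset F} {p : ℝ} (hp : US.HasSoundnessError H d p)
    (hfalse : ∑ a ∈ H, (toUnivariate g).eval a ≠ foldSum m z S y) :
    foldDecision pcs US P f S X z sec pp st C y g true ≤ ENNReal.ofReal p := by
  rw [foldDecision, bind_apply_true]
  refine expec_le fun e => ?_
  calc _ ≤ ((US (toUnivariate g) (foldSum m z S y)).interact (P.run sec) e.2).map Prod.fst
          true := by
        rw [map_decide_apply_true, apply_true_eq_expec, expec_map]
        refine expec_mono fun u => ?_
        split_ifs with accepts sum_accepted
        · exact le_rfl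
        · exact absurd accepts.2.2.2.2 sum_accepted
        · exact zero_le
        · exact le_rfl
    _ ≤ ENNReal.ofReal p := by
        rw [← ofReal_prob]
        exact ENNReal.ofReal_le_ofReal (hp _ _
          (natDegree_toUnivariate_le (Nat.two_pow_pos m) g) hfalse (P.run sec) e.2)

open Classical in
/-- The total weight of the failures of the commitment scheme after a conversation with final state
`st` and replies `C`: the last commitment opens twice, or the evaluation protocol accepts false
values. -/
noncomputable def foldFailure (pcs : PCS F (2 ^ m) d D) (X : Fin (2 ^ m) → F) (sec : ℕ)
    (pp st : Dat) (C : ℕ → Dat) : ℝ≥0∞ :=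
  (if pcs.OpensTwice pp (C m) then 1 else 0) +
    pcs.falseEval (foldPlacement m) P sec pp st (foldCommitments m C) X

theorem foldDecision_true_le_falseEval {G : ℕ → BPoly F (2 ^ m) d D}
    (hG : ∀ j ≤ m, C j = pcs.commit pp (G j)) (hy : y ≠ foldValues X G) :
    foldDecision pcs US P f S X z sec pp st C y g true ≤
      pcs.falseEval (foldPlacement m) P sec pp st (foldCommitments m C) X := by
  classical
  refine (foldDecision_true_le_convinceProb P X z sec pp st).trans ?_
  refine le_trans (le_of_eq ?_) (Finset.single_le_sum (fun _ _ => zero_le)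
    (Finset.mem_filter.2 ⟨Finset.mem_univ (fun i => G (foldIndex m i), y), hy⟩))
  rw [if_pos fun i => (foldCommitments_eq C i).trans (hG _ (foldIndex_le i))]

theorem foldDecision_true_le_foldPayoff {H : Finset F} {p : ℝ}
    (hp : US.HasSoundnessError H d p) {G : ℕ → BPoly F (2 ^ m) d D} (hg : g = G m)
    (hy : y = foldValues X G) :
    foldDecision pcs US P f S X z sec pp st C y g true ≤
      foldPayoff H f S (ENNReal.ofReal p) X z G := by
  subst hg hy
  unfold foldPayoff
  split_ifs with consistent hsum
  · exact PMF.coe_le_one _ _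
  · exact foldDecision_true_le_ofReal P X z sec pp st hp hsum
  · exact (foldDecision_true_eq_zero P X z sec pp st fun h => consistent h.2.2).le

/-- If no failure occurs, the prover has sent the true values of the polynomials that `Γ` chooses
for his commitments. -/
theorem foldDecision_true_le {H : Finset F} {p : ℝ} (hp : US.HasSoundnessError H d p)
    {Γ : Dat → BPoly F (2 ^ m) d D} (hΓ : ∀ C, pcs.IsCommitment pp C → C = pcs.commit pp (Γ C)) :
    foldDecision pcs US P f S X z sec pp st C y g true ≤
      foldPayoff H f S (ENNReal.ofReal p) X z (fun j => Γ (C j)) +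
        foldFailure P pcs X sec pp st C := by
  by_cases valid : (∀ j < m, pcs.IsCommitment pp (C j)) ∧ pcs.opens pp g (C m) = true
  swap
  · rw [foldDecision_true_eq_zero P X z sec pp st fun h => valid ⟨h.1, h.2.1⟩]
    exact zero_le
  have opens_g : C m = pcs.commit pp g := (pcs.opens_iff pp g _).1 valid.2
  have commit_eq (j : ℕ) (hj : j ≤ m) : C j = pcs.commit pp (Γ (C j)) := by
    refine hΓ _ ?_
    rcases hj.lt_or_eq with hj | rfl
    · exact valid.1 j hj
    · exact ⟨g, opens_g⟩
  by_cases hg : g = Γ (C m)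
  swap
  · have opens_twice : pcs.OpensTwice pp (C m) := ⟨g, _, hg, opens_g, commit_eq m le_rfl⟩
    rw [foldFailure, if_pos opens_twice]
    exact (PMF.coe_le_one _ _).trans (le_self_add.trans le_add_self)
  by_cases hy : y = foldValues X fun j => Γ (C j)
  · exact (foldDecision_true_le_foldPayoff P X z sec pp st hp hg hy).trans le_self_add
  · exact (foldDecision_true_le_falseEval P X z sec pp st commit_eq hy).trans
      (le_add_self.trans le_add_self)

theorem foldVerdict_true_le {H : Finset F} {p : ℝ} (hp : US.HasSoundnessError H d p)
    {Γ : Dat → BPoly F (2 ^ m) d D} (hΓ : ∀ C, pcs.IsCommitment pp C → C = pcs.commit pp (Γ C))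
    (r : Dat × List Dat) : foldVerdict pcs US P f S X z sec pp r true ≤
      foldPayoff H f S (ENNReal.ofReal p) X z (polysOf Γ r.2) +
        foldFailure P pcs X sec pp r.1 fun j => r.2.getD j Dat.nil := by
  unfold foldVerdict
  split
  · exact foldDecision_true_le P X z sec pp r.1 hp hΓ
  · simp

variable (f S)

theorem expec_foldPayoff_foldTalk_le (H : Finset F) {p : ℝ≥0∞} (hp : p ≤ 1)
    (Γ : Dat → BPoly F (2 ^ m) d D) {b : ℕ → ℝ≥0∞}
    (hb₀ : max p ((D : ℝ≥0∞) / Fintype.card F) ≤ b 0)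
    (hb : ∀ n, max ((D : ℝ≥0∞) / Fintype.card F) (1 / Fintype.card F) * (1 - b n) + b n ≤
      b (n + 1))
    (hS : ∑ a ∈ Fintype.piFinset (fun _ : Fin (2 ^ m) => H), MvPolynomial.eval a f.1 ≠ S) :
    (expec (PMF.uniformOfFintype (Fin (2 ^ m) → F)) fun X =>
      expec (PMF.uniformOfFintype (Fin m → F)) fun z => expec (foldTalk P f S X z sec pp) fun r =>
        foldPayoff H f S p X z (polysOf Γ r.2)) ≤ b m := by
  have claim_false : ¬ FoldTrue H f S 0 0 (polysOf Γ []) ([] : List Dat).length := by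
    simpa [FoldTrue, tailSum, cube, foldPoly, foldClaim, foldStart_zero, splice_zero] using hS
  simpa only [futurePayoff, expectedPayoff, foldTalk, List.length_nil, foldStart_zero,
    splice_zero] using
    futurePayoff_le H f S p Γ (P.run sec) hp hb₀ hb
      (startState (Dat.cons pp (Dat.cons (codePoly f) (code S)))) (zero_add m) claim_false

variable (pcs) in
/-- The expected total weight of the failures of the commitment scheme in a run of Fold-DCS. It
bounds the amount by which the commitment scheme raises the probability of acceptance. -/
noncomputable def foldError : ℝ≥0∞ :=
  expec (PMF.uniformOfFintype (Fin (2 ^ m) → F)) fun X =>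
    expec (PMF.uniformOfFintype (Fin m → F)) fun z => expec (pcs.setup sec) fun pp =>
      expec (foldTalk P f S X z sec pp) fun r =>
        foldFailure P pcs X sec pp r.1 fun j => r.2.getD j Dat.nil

theorem efficient_foldTalk : Efficient fun sec pp =>
    (foldTalk P f S X z sec pp).map encodeTalk :=
  efficient_talk P (foldMsg m X z)
    (φ := fun pp => startState (Dat.cons pp (Dat.cons (codePoly f) (code S))))
    (efficientDet_nil.cons (efficientDet_id.cons (efficientDet_const _))) (m + 2)

theorem nth_encodeTalk_of_mem_support_foldTalk {X : Fin (2 ^ m) → F} {z : Fin m → F} {sec : ℕ}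
    {pp : Dat} {r : Dat × List Dat} (hr : r ∈ (foldTalk P f S X z sec pp).support) {j : ℕ}
    (hj : j ≤ m) : (encodeTalk r).tl.nth (m + 1 - j) = r.2.getD j Dat.nil :=
  nth_encodeTalk (length_of_mem_support_talk hr) (hj.trans m.le_succ)

open Classical in
theorem eNegligible_opensTwice_foldTalk (hbind : pcs.Binding) :
    ENegligible fun sec => expec (pcs.setup sec) fun pp => expec (foldTalk P f S X z sec pp)
      fun r => if pcs.OpensTwice pp (r.2.getD m Dat.nil) then 1 else 0 := by
  refine (hbind.eNegligible_opensTwice ((efficient_foldTalk P f S X z).map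
    (efficientDet_tl.nth (m + 1 - m)))).mono fun sec => expec_mono fun pp => ?_
  rw [expec_map, expec_map]
  refine expec_mono_of_support fun r hr => ?_
  rw [nth_encodeTalk_of_mem_support_foldTalk P f S hr le_rfl]

theorem eNegligible_falseEval_foldTalk (heval : pcs.BatchEvalBinding (foldPlacement m)) :
    ENegligible fun sec => expec (pcs.setup sec) fun pp => expec (foldTalk P f S X z sec pp)
      fun r => pcs.falseEval (foldPlacement m) P sec pp r.1
        (foldCommitments m fun j => r.2.getD j Dat.nil) X := by
  refine (heval.eNegligible_falseEval ((efficient_foldTalk P f S X z).map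
    (efficientDet_hd.cons (EfficientDet.ofList_ofFn fun i : Fin (2 * m + 1) =>
      efficientDet_tl.nth (m + 1 - foldIndex m i)))) P X).mono fun sec => expec_mono fun pp => ?_
  rw [expec_map, expec_map]
  refine expec_mono_of_support fun r hr => le_of_eq ?_
  congr 1
  funext i
  rw [foldCommitments_eq, Dat.tl, Dat.nth_ofList_ofFn,
    nth_encodeTalk_of_mem_support_foldTalk P f S hr (foldIndex_le i)]

theorem eNegligible_foldError (hbind : pcs.Binding)
    (heval : pcs.BatchEvalBinding (foldPlacement m)) :
    ENegligible fun sec => foldError pcs P f S sec := by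
  refine ENegligible.expec_uniform fun X => ENegligible.expec_uniform fun z => ?_
  simp only [foldFailure, expec_add]
  exact (eNegligible_opensTwice_foldTalk P f S X z hbind).add
    (eNegligible_falseEval_foldTalk P f S X z heval)

/-- The soundness of Fold-DCS up to failures of the commitment scheme, with the bound given by any
sequence that satisfies the recursion of the rounds. -/
theorem foldDCS_true_le {H : Finset F} {p : ℝ} (hp : US.HasSoundnessError H d p)
    (hp₁ : p ≤ 1) {b : ℕ → ℝ≥0∞}
    (hb₀ : max (ENNReal.ofReal p) ((D : ℝ≥0∞) / Fintype.card F) ≤ b 0)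
    (hb : ∀ n, max ((D : ℝ≥0∞) / Fintype.card F) (1 / Fintype.card F) * (1 - b n) + b n ≤
      b (n + 1))
    (hS : ∑ a ∈ Fintype.piFinset (fun _ : Fin (2 ^ m) => H), MvPolynomial.eval a f.1 ≠ S) :
    foldDCS pcs US P sec f S true ≤ b m + foldError pcs P f S sec := by
  have exists_committed (pp C : Dat) :
      ∃ g : BPoly F (2 ^ m) d D, pcs.IsCommitment pp C → C = pcs.commit pp g :=
    (em (pcs.IsCommitment pp C)).elim (fun ⟨g, hg⟩ => ⟨g, fun _ => hg⟩)
      fun hC => ⟨f, fun hC' => absurd hC' hC⟩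
  choose Γ hΓ using exists_committed
  simp only [foldDCS_eq, bind_apply_true]
  calc _ ≤ expec (pcs.setup sec) fun pp => expec (PMF.uniformOfFintype (Fin (2 ^ m) → F)) fun X =>
          expec (PMF.uniformOfFintype (Fin m → F)) fun z => expec (foldTalk P f S X z sec pp)
            fun r => foldPayoff H f S (ENNReal.ofReal p) X z (polysOf (Γ pp) r.2) +
              foldFailure P pcs X sec pp r.1 fun j => r.2.getD j Dat.nil :=
        expec_mono fun pp => expec_mono fun X => expec_mono fun z => expec_mono fun r =>
          foldVerdict_true_le P X z sec pp hp (hΓ pp) r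
    _ ≤ b m + foldError pcs P f S sec := by
        simp only [expec_add]
        refine add_le_add (expec_le fun pp => expec_foldPayoff_foldTalk_le P f S sec pp H
          (ENNReal.ofReal_le_one.2 hp₁) (Γ pp) hb₀ hb hS) (le_of_eq ?_)
        rw [expec_comm, foldError]
        exact congrArg _ (funext fun X => expec_comm _ _ _)

end

/-! ### The bound -/

section

variable {m D q : ℕ}

theorem one_sub_roundError (D q : ℕ) : 1 - (((D : ℝ) + 1) / q - D / (q : ℝ) ^ 2) =
    (1 - D / q) * (1 - 1 / q) := by
  ring

theorem natCast_div_le_one (hDq : D ≤ q) : (D : ℝ) / q ≤ 1 :=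
  div_le_one_of_le₀ (Nat.cast_le.2 hDq) q.cast_nonneg

theorem one_div_natCast_le_one (q : ℕ) : 1 / (q : ℝ) ≤ 1 := by
  simpa using Nat.cast_inv_le_one (α := ℝ) q

theorem one_sub_roundError_nonneg (hDq : D ≤ q) :
    0 ≤ 1 - (((D : ℝ) + 1) / q - D / (q : ℝ) ^ 2) := by
  rw [one_sub_roundError]
  exact mul_nonneg (sub_nonneg.2 (natCast_div_le_one hDq))
    (sub_nonneg.2 (one_div_natCast_le_one q))

theorem one_sub_roundError_le (hDq : D ≤ q) :
    1 - (((D : ℝ) + 1) / q - D / (q : ℝ) ^ 2) ≤ 1 - max ((D : ℝ) / q) (1 / q) := by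
  have div_nonneg : (0 : ℝ) ≤ D / q := by positivity
  have one_div_nonneg : (0 : ℝ) ≤ 1 / q := by positivity
  rw [one_sub_roundError]
  rcases max_choice ((D : ℝ) / q) (1 / q) with h | h <;> rw [h]
  · exact mul_le_of_le_one_right (sub_nonneg.2 (natCast_div_le_one hDq)) (by linarith)
  · exact mul_le_of_le_one_left (sub_nonneg.2 (one_div_natCast_le_one q)) (by linarith)

theorem ofReal_soundness_step {x c M : ℝ} (hx : 0 ≤ x) (hc₀ : 0 ≤ c) (hc : c ≤ 1 - x)
    (hM₀ : 0 ≤ M) (hM₁ : M ≤ 1) (n : ℕ) :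
    ENNReal.ofReal x * (1 - ENNReal.ofReal (1 - c ^ n * (1 - M))) +
        ENNReal.ofReal (1 - c ^ n * (1 - M)) ≤
      ENNReal.ofReal (1 - c ^ (n + 1) * (1 - M)) := by
  set t := c ^ n * (1 - M) with ht
  have t_nonneg : 0 ≤ t := mul_nonneg (pow_nonneg hc₀ n) (sub_nonneg.2 hM₁)
  have t_le_one : t ≤ 1 :=
    mul_le_one₀ (pow_le_one₀ hc₀ (by linarith)) (sub_nonneg.2 hM₁) (by linarith)
  rw [← ENNReal.ofReal_one, ← ENNReal.ofReal_sub _ (sub_nonneg.2 t_le_one), sub_sub_cancel,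
    ← ENNReal.ofReal_mul hx, ← ENNReal.ofReal_add (mul_nonneg hx t_nonneg)
      (sub_nonneg.2 t_le_one), pow_succ', mul_assoc, ← ht]
  refine ENNReal.ofReal_le_ofReal ?_
  linarith [mul_le_mul_of_nonneg_right hc t_nonneg]

/-- Bernoulli's inequality for `m + 1` rounds, the last of which has error `D / q`. -/
theorem soundnessBound_le (hDq : D ≤ q) {p : ℝ} (hp : p ≤ (D : ℝ) / q) (ε : ℝ) :
    soundnessBound m D q p ε 0 ≤ (m + 1) * (ε + ((D : ℝ) + 1) / q * (1 + 0)) := by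
  rw [soundnessBound, max_eq_right hp, add_zero]
  have c_nonneg := one_sub_roundError_nonneg hDq
  have c_le : 1 - (((D : ℝ) + 1) / q - D / (q : ℝ) ^ 2) ≤ 1 - (D : ℝ) / q :=
    (one_sub_roundError_le hDq).trans (sub_le_sub_left (le_max_left _ _) 1)
  set δ := ((D : ℝ) + 1) / q - D / (q : ℝ) ^ 2
  have error_le : δ ≤ ((D : ℝ) + 1) / q := sub_le_self _ (by positivity)
  have last_round : (1 - δ) ^ (m + 1) ≤ (1 - δ) ^ m * (1 - (D : ℝ) / q) := by
    rw [pow_succ]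
    exact mul_le_mul_of_nonneg_left c_le (pow_nonneg c_nonneg m)
  have bernoulli : 1 + ((m + 1 : ℕ) : ℝ) * -δ ≤ (1 + -δ) ^ (m + 1) :=
    one_add_mul_le_pow (by linarith) (m + 1)
  rw [← sub_eq_add_neg] at bernoulli
  push_cast at bernoulli
  calc _ ≤ (m + 1) * ε + (m + 1) * δ := by linarith
    _ ≤ (m + 1) * ε + (m + 1) * (((D : ℝ) + 1) / q) := by gcongr
    _ = _ := by ring

end

section

variable {F : Type*} [Field F] [Fintype F] {m d D : ℕ}

theorem ofReal_natCast_div (n : ℕ) :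
    ENNReal.ofReal ((n : ℝ) / Fintype.card F) = (n : ℝ≥0∞) / Fintype.card F := by
  rw [ENNReal.ofReal_div_of_pos (Nat.cast_pos.2 Fintype.card_pos), ENNReal.ofReal_natCast,
    ENNReal.ofReal_natCast]

theorem ofReal_prob_foldDCS_le {H : Finset F} (hDF : D ≤ Fintype.card F)
    {pcs : PCS F (2 ^ m) d D} {US : USVerifier F} {p : ℝ} (hp : US.HasSoundnessError H d p)
    (hM : max p (D / Fintype.card F) ≤ 1) (P : PPT) (sec : ℕ) {f : BPoly F (2 ^ m) d D} {S : F}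
    (hS : ∑ a ∈ Fintype.piFinset (fun _ : Fin (2 ^ m) => H), MvPolynomial.eval a f.1 ≠ S) :
    ENNReal.ofReal (prob (foldDCS pcs US P sec f S)) ≤
      ENNReal.ofReal (1 - (1 - (((D : ℝ) + 1) / Fintype.card F -
        D / (Fintype.card F : ℝ) ^ 2)) ^ m * (1 - max p (D / Fintype.card F))) +
          foldError pcs P f S sec := by
  rw [ofReal_prob]
  have one_div_eq := ofReal_natCast_div (F := F) 1
  rw [Nat.cast_one, Nat.cast_one] at one_div_eq
  refine foldDCS_true_le P f S sec hp ((le_max_left _ _).trans hM) (b := fun n =>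
    ENNReal.ofReal (1 - (1 - (((D : ℝ) + 1) / Fintype.card F -
      D / (Fintype.card F : ℝ) ^ 2)) ^ n * (1 - max p (D / Fintype.card F)))) ?_ (fun n => ?_) hS
  · rw [pow_zero, one_mul, sub_sub_cancel, ENNReal.ofReal_max, ofReal_natCast_div]
  · rw [← ofReal_natCast_div, ← one_div_eq, ← ENNReal.ofReal_max]
    exact ofReal_soundness_step (by positivity) (one_sub_roundError_nonneg hDF)
      (one_sub_roundError_le hDF) (le_max_of_le_right (by positivity)) hM n

theorem prob_foldDCS_le {H : Finset F} (hDF : D ≤ Fintype.card F) {pcs : PCS F (2 ^ m) d D}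
    {US : USVerifier F} {p : ℝ} (hp : US.HasSoundnessError H d p) (P : PPT) {sec : ℕ}
    {f : BPoly F (2 ^ m) d D} {S : F} {ε : ℝ} (hε : 0 ≤ ε)
    (herror : foldError pcs P f S sec ≤ ENNReal.ofReal ε)
    (hS : ∑ a ∈ Fintype.piFinset (fun _ : Fin (2 ^ m) => H), MvPolynomial.eval a f.1 ≠ S) :
    prob (foldDCS pcs US P sec f S) ≤ soundnessBound m D (Fintype.card F) p ε 0 := by
  have c_nonneg := one_sub_roundError_nonneg hDF
  have c_le_one : 1 - (((D : ℝ) + 1) / Fintype.card F - D / (Fintype.card F : ℝ) ^ 2) ≤ 1 :=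
    (one_sub_roundError_le hDF).trans (sub_le_self _ (le_max_of_le_left (by positivity)))
  have M_nonneg : 0 ≤ max p ((D : ℝ) / Fintype.card F) := le_max_of_le_right (by positivity)
  have ε_le : ε ≤ (m + 1) * ε := le_mul_of_one_le_left hε (by simp)
  have pow_nonneg := pow_nonneg c_nonneg m
  rw [soundnessBound, add_zero]
  rcases le_or_gt (max p ((D : ℝ) / Fintype.card F)) 1 with hM | hM
  · have ideal_nonneg := sub_nonneg.2
      (mul_le_one₀ (pow_le_one₀ c_nonneg c_le_one (n := m)) (sub_nonneg.2 hM) (by linarith))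
    have prob_le := (ofReal_prob_foldDCS_le hDF hp hM P sec hS).trans
      (add_le_add_right herror _)
    rw [← ENNReal.ofReal_add ideal_nonneg hε,
      ENNReal.ofReal_le_ofReal_iff (add_nonneg ideal_nonneg hε)] at prob_le
    linarith
  · have prob_le := prob_le_one (foldDCS pcs US P sec f S)
    have := mul_nonpos_of_nonneg_of_nonpos pow_nonneg (sub_nonpos.2 hM.le)
    linarith

end

theorem mainTheorem3_general {F : Type*} [Field F] [Fintype F] (H : Finset F) (m d D : ℕ)
    (hDF : D ≤ Fintype.card F) (pcs : PCS F (2 ^ m) d D) (hbind : pcs.Binding)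
    (heval : pcs.BatchEvalBinding (foldPlacement m))
    (US : USVerifier F) (p : ℝ) (hp : US.HasSoundnessError H d p) (P : PPT) :
    ∃ ε σ : ℕ → ℝ, Negligible ε ∧ Negligible σ ∧ (∀ sec, 0 ≤ ε sec) ∧ (∀ sec, 0 ≤ σ sec) ∧
      (∀ (sec : ℕ) (f : BPoly F (2 ^ m) d D) (S : F),
        ∑ a ∈ Fintype.piFinset (fun _ : Fin (2 ^ m) => H), MvPolynomial.eval a f.1 ≠ S →
        prob (foldDCS pcs US P sec f S) ≤
          soundnessBound m D (Fintype.card F) p (ε sec) (σ sec)) ∧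
      (p ≤ (D : ℝ) / Fintype.card F → ∀ sec,
        soundnessBound m D (Fintype.card F) p (ε sec) (σ sec) ≤
          (m + 1) * (ε sec + ((D : ℝ) + 1) / Fintype.card F * (1 + σ sec))) := by
  obtain ⟨ε, hε, ε_nonneg, error_le⟩ := ENegligible.exists_uniform_bound
    fun claim : BPoly F (2 ^ m) d D × F =>
      eNegligible_foldError P claim.1 claim.2 hbind heval
  exact ⟨ε, fun _ => 0, hε, Negligible.zero, ε_nonneg, fun _ => le_rfl,
    fun sec f S hS => prob_foldDCS_le hDF hp P (ε_nonneg sec) (error_le (f, S) sec) hS,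
    fun hpD sec => soundnessBound_le hDF hpD (ε sec)⟩

theorem mainTheorem3 {F : Type*} [Field F] [Fintype F] (H : Finset F)
    (m d D : ℕ) (hm : 1 ≤ m) (hd : 1 ≤ d) (hD : 1 ≤ D) (hDF : D ≤ Fintype.card F)
    (pcs : PCS F (2 ^ m) d D) (hext : pcs.Extractable) (hbind : pcs.Binding)
    (heval : pcs.BatchEvalBinding (foldPlacement m))
    (US : USVerifier F) (p : ℝ) (hp : US.HasSoundnessError H d p) (P : PPT) :
    ∃ ε σ : ℕ → ℝ, Negligible ε ∧ Negligible σ ∧ (∀ sec, 0 ≤ ε sec) ∧ (∀ sec, 0 ≤ σ sec) ∧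
      (∀ (sec : ℕ) (f : BPoly F (2 ^ m) d D) (S : F),
        ∑ a ∈ Fintype.piFinset (fun _ : Fin (2 ^ m) => H), MvPolynomial.eval a f.1 ≠ S →
        prob (foldDCS pcs US P sec f S) ≤
          soundnessBound m D (Fintype.card F) p (ε sec) (σ sec)) ∧
      (p ≤ (D : ℝ) / Fintype.card F → ∀ sec,
        soundnessBound m D (Fintype.card F) p (ε sec) (σ sec) ≤
          (m + 1) * (ε sec + ((D : ℝ) + 1) / Fintype.card F * (1 + σ sec))) :=
  mainTheorem3_general H m d D hDF pcs hbind heval US p hp P
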